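/- Let $N\ge 1$, let $\Omega\subset\mathbb{R}^N$ be a smooth bounded domain, and let $f:\mathbb{R}^d\to\mathbb{R}$ be a map of class $W^{2,\infty}_{loc}$ (identified with its continuous representative, which is $C^1$). For $\lambda>0$ consider the functional $$E_\lambda(u)=\int_\Omega \frac{1}{2\lambda^2}|\nabla u|^2+\int_\Omega f(u),$$ and call critical point of $E_\lambda$ any $u\in H^1(\Omega)^d$ such that $\nabla f(u)\in L^1_{loc}(\Omega)^d$ and $$\Delta u=\lambda^2\,\nabla f(u)\quad\text{in }\mathcal{D}'(\Omega).$$ Assume that there exists $C>0$ such that $\nabla f(x)\cdot x\ge 0$ for every $x\in\mathbb{R}^d$ with $|x|\ge C$, and let $g\in L^\infty\cap H^{1/2}(\partial\Omega)^d$. Then there exists $\lambda_0=\lambda_0(\Omega,f,g)>0$ such that, for every $\lambda\in(0,\lambda_0)$, $E_\lambda$ has at most one critical point $u$ with $\operatorname{tr} u=g$ on $\partial\Omega$. -/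

import Mathlib

open MeasureTheory Filter Topology TopologicalSpace
open scoped ENNReal Distributions

noncomputable section

namespace SmallParameter

/-- The Euclidean space `ℝⁿ`. -/
abbrev Euc (n : ℕ) : Type := EuclideanSpace ℝ (Fin n)

/-- The classical partial derivative `∂ᵢ φ` of a function on `ℝᴺ`. -/
def pderiv {N : ℕ} {F : Type*} [NormedAddCommGroup F] [NormedSpace ℝ F]
    (i : Fin N) (φ : Euc N → F) (x : Euc N) : F :=
  fderiv ℝ φ x (EuclideanSpace.single i 1)

/-- `w` is the weak `i`-th partial derivative of `u` on the open set `Ω`: both are locally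
integrable on `Ω` and `∫_Ω (∂ᵢ φ) u = - ∫_Ω φ w` for all `φ ∈ C_c^∞(Ω)`. -/
def HasWeakPartial {N : ℕ} {F : Type*} [NormedAddCommGroup F] [NormedSpace ℝ F]
    (Ω : Opens (Euc N)) (i : Fin N) (u w : Euc N → F) : Prop :=
  LocallyIntegrableOn u (Ω : Set (Euc N)) ∧ LocallyIntegrableOn w (Ω : Set (Euc N)) ∧
    ∀ φ : 𝓓(Ω, ℝ),
      ∫ x in (Ω : Set (Euc N)), pderiv i φ x • u x = -∫ x in (Ω : Set (Euc N)), φ x • w x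

/-- `h ∈ L^∞_loc(ℝᵈ)`. -/
def MemLinftyLoc {d : ℕ} (h : Euc d → ℝ) : Prop :=
  ∀ K : Set (Euc d), IsCompact K → MemLp h ∞ (volume.restrict K)

/-- `f ∈ W^{2,∞}_loc(ℝᵈ)`: `f` and its weak derivatives of order one (`p i`) and two (`q i j`) are
in `L^∞_loc(ℝᵈ)`. -/
def MemW2InftyLoc {d : ℕ} (f : Euc d → ℝ) : Prop :=
  MemLinftyLoc f ∧ ∃ (p : Fin d → Euc d → ℝ) (q : Fin d → Fin d → Euc d → ℝ),
    (∀ i, MemLinftyLoc (p i) ∧ HasWeakPartial ⊤ i f (p i)) ∧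
    ∀ i j, MemLinftyLoc (q i j) ∧ HasWeakPartial ⊤ j (p i) (q i j)

/-- `u ∈ H¹(Ω)ᵈ`: `u` is in `L²(Ω)` and has weak first derivatives in `L²(Ω)`. -/
def MemH1 {N d : ℕ} (Ω : Opens (Euc N)) (u : Euc N → Euc d) : Prop :=
  MemLp u 2 (volume.restrict Ω) ∧
    ∀ i, ∃ w : Euc N → Euc d, HasWeakPartial Ω i u w ∧ MemLp w 2 (volume.restrict Ω)

/-- The boundary of `Ω` is smooth: near each of its points, `Ω` is the region lying on one side of
the graph of a `C^∞` function over a hyperplane `νᗮ`. A function on `νᗮ` is represented by a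
function on `ℝᴺ` that is invariant under translations along `ν`. -/
def HasSmoothBoundary {N : ℕ} (Ω : Opens (Euc N)) : Prop :=
  ∀ x₀ ∈ frontier (Ω : Set (Euc N)), ∃ (r : ℝ) (ν : Euc N) (γ : Euc N → ℝ),
    0 < r ∧ ‖ν‖ = 1 ∧ ContDiff ℝ (⊤ : ℕ∞) γ ∧ (∀ x (t : ℝ), γ (x + t • ν) = γ x) ∧
      (Ω : Set (Euc N)) ∩ Metric.ball x₀ r = {x ∈ Metric.ball x₀ r | inner ℝ ν x < γ x}

/-- `Ω` is a smooth bounded domain. -/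
def IsSmoothBoundedDomain {N : ℕ} (Ω : Opens (Euc N)) : Prop :=
  IsConnected (Ω : Set (Euc N)) ∧ Bornology.IsBounded (Ω : Set (Euc N)) ∧ HasSmoothBoundary Ω

/-- The surface measure of `∂Ω`: the `(N-1)`-dimensional Hausdorff measure on `∂Ω`. -/
def surfaceMeasure {N : ℕ} (Ω : Opens (Euc N)) : Measure (Euc N) :=
  (Measure.hausdorffMeasure ((N : ℝ) - 1)).restrict (frontier (Ω : Set (Euc N)))

/-- `g ∈ H^{1/2}(∂Ω)ᵈ`: `g ∈ L²(∂Ω)` with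
`∬_{∂Ω × ∂Ω} |g(x) - g(y)|² / |x - y|^N < ∞`. -/
def MemHHalf {N d : ℕ} (Ω : Opens (Euc N)) (g : Euc N → Euc d) : Prop :=
  MemLp g 2 (surfaceMeasure Ω) ∧
    ∫⁻ x, ∫⁻ y, ‖g x - g y‖ₑ ^ 2 / edist x y ^ N ∂(surfaceMeasure Ω) ∂(surfaceMeasure Ω) < ∞

/-- `tr u = g` on `∂Ω` for `u ∈ H¹(Ω)ᵈ`. The trace is the continuous extension to `H¹(Ω)` of the
restriction to `∂Ω` of functions that are smooth up to the boundary: some sequence of smooth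
functions `ψ k` converges to `u` in `H¹(Ω)` and its restrictions to `∂Ω` converge to `g` in
`L²(∂Ω)`. -/
def HasTrace {N d : ℕ} (Ω : Opens (Euc N)) (u g : Euc N → Euc d) : Prop :=
  ∃ ψ : ℕ → Euc N → Euc d,
    (∀ k, ContDiff ℝ (⊤ : ℕ∞) (ψ k)) ∧
    Tendsto (fun k ↦ eLpNorm (u - ψ k) 2 (volume.restrict Ω)) atTop (𝓝 0) ∧
    (∀ i, ∃ w : Euc N → Euc d, HasWeakPartial Ω i u w ∧
      Tendsto (fun k ↦ eLpNorm (w - pderiv i (ψ k)) 2 (volume.restrict Ω)) atTop (𝓝 0)) ∧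
    Tendsto (fun k ↦ eLpNorm (g - ψ k) 2 (surfaceMeasure Ω)) atTop (𝓝 0)

/-- `u` is a critical point of `E_lam(u) = ∫_Ω |∇u|² / (2 lam²) + ∫_Ω f(u)`, i.e. `u ∈ H¹(Ω)ᵈ`,
`∇f(u) ∈ L¹_loc(Ω)ᵈ` and `Δu = lam² ∇f(u)` in the sense of distributions on `Ω`. -/
def IsCriticalPoint {N d : ℕ} (Ω : Opens (Euc N)) (f : Euc d → ℝ) (lam : ℝ)
    (u : Euc N → Euc d) : Prop :=
  MemH1 Ω u ∧ LocallyIntegrableOn (fun x ↦ gradient f (u x)) (Ω : Set (Euc N)) ∧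
    ∀ φ : 𝓓(Ω, ℝ),
      ∫ x in (Ω : Set (Euc N)), (Laplacian.laplacian (φ : Euc N → ℝ) x) • u x =
        lam ^ 2 • ∫ x in (Ω : Set (Euc N)), φ x • gradient f (u x)

end SmallParameter

end

/-!
Both the boundedness of critical points and their uniqueness follow from one comparison principle,
`H1Approx.ae_comp_eq_zero`. Let `Δu = h` in `Ω`, with `u ∈ H¹` and `h` locally integrable, and let
`p ≥ 0` be a smooth convex function with bounded first and second derivatives which vanishes on the
trace of `u`. If `p'(u) h ≥ -κ p(u)`, then Kato's inequality (`sum_integral_pderiv_mul_le`) shows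
that `P = p(u)` satisfies `-ΔP ≤ κ P` weakly in `Ω`. Since `P` has zero trace, it may be used as a
test function, so `∫ |∇P|² ≤ κ ∫ P²` (`H1Approx.sum_integral_sq_le`), while Poincaré's inequality
gives `∫ P² ≤ 4 R² ∫ |∇P|²` if `Ω` is contained in the ball of radius `R`
(`H1Approx.integral_sq_le`). Hence `P = 0` as soon as `4 R² κ < 1`.

Applied with a convex radial function that vanishes exactly on the ball of radius
`M = max(C, ‖g‖_∞)`, where `p'(u) ∇f(u) ≥ 0` and `κ = 0`, this shows that all critical points with
trace `g` are bounded by `M`, whatever `λ` is (`IsCriticalPoint.ae_norm_le`). On the ball of radius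
`M` the gradient of `f` is `L`-Lipschitz (`MemW2InftyLoc.exists_norm_gradient_sub_le`). Applied
with `p(y) = √(1 + |y|²) - 1` to the difference of two critical points, for which
`κ = 2 λ² L`, it gives uniqueness for small `λ` (`IsCriticalPoint.ae_eq`).

No trace theorem is used. A function with a trace comes with smooth functions on `ℝᴺ` that converge
to it in `H¹(Ω)` and to its trace in `L²(∂Ω)`. The link between the two convergences is the
inequality `|∫_Ω ∂ᵢζ| ≤ ∫ |ζ| dμ`, where `μ` is a finite measure dominated by a multiple of the
surface measure (`IsSmoothBoundedDomain.exists_measure_enorm_integral_pderiv_le`), obtained by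
flattening the boundary. It implies that a function with zero trace extends by zero to a weakly
differentiable function on `ℝᴺ` (`H1Approx.integral_mul_pderiv`). The extension, localized by a
partition of unity, is pushed into `Ω` and smoothed by convolution with a kernel centred off the
origin (`H1Approx.sum_integral_mul_localized_le`), which makes it an admissible test function.
-/

namespace SmallParameter

open Set Metric
open scoped RealInnerProductSpace Convolution

/-! ### Coordinates adapted to a direction -/

/-- Every `x` is `t ν + J y` with `t = ⟪ν, x⟫` and `y = π x`, and these coordinates preserve volume.
The space of the `y` carries the sup norm, for which the Hausdorff measure is known to be the
Lebesgue measure. -/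
lemma exists_coordinates {n : ℕ} {ν : Euc (n + 1)} (hν : ‖ν‖ = 1) :
    ∃ (J : (Fin n → ℝ) →L[ℝ] Euc (n + 1)) (π : Euc (n + 1) →L[ℝ] (Fin n → ℝ)),
      (∀ y, π (J y) = y) ∧ (∀ y, ⟪ν, J y⟫ = 0) ∧ π ν = 0 ∧ (∀ x, ⟪ν, x⟫ • ν + J (π x) = x) ∧
      LipschitzWith 1 π ∧
      MeasurePreserving (fun p : (Fin n → ℝ) × ℝ ↦ p.2 • ν + J p.1)
        (volume.prod volume) volume := by
  obtain ⟨b, hb⟩ := Orthonormal.exists_orthonormalBasis_extension_of_card_eq (𝕜 := ℝ)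
    (E := Euc (n + 1)) (ι := Fin (n + 1)) (by simp) (v := fun _ ↦ ν) (s := {0})
    (by
      rw [orthonormal_iff_ite]
      rintro ⟨i, hi⟩ ⟨j, hj⟩
      rw [mem_singleton_iff] at hi hj
      subst hi; subst hj
      simp [hν])
  have hb0 : b 0 = ν := hb 0 rfl
  let J : (Fin n → ℝ) →L[ℝ] Euc (n + 1) :=
    ∑ k : Fin n, (ContinuousLinearMap.proj k : (Fin n → ℝ) →L[ℝ] ℝ).smulRight (b k.succ)
  let π : Euc (n + 1) →L[ℝ] (Fin n → ℝ) :=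
    ContinuousLinearMap.pi fun k ↦ innerSL ℝ (b k.succ)
  have hJ : ∀ y, J y = ∑ k : Fin n, y k • b k.succ := fun y ↦ by
    simp [J]
  have hπ : ∀ x k, π x k = ⟪b k.succ, x⟫ := fun x k ↦ by simp [π]
  have hbb : ∀ i j, ⟪b i, b j⟫ = if i = j then (1 : ℝ) else 0 :=
    orthonormal_iff_ite.mp b.orthonormal
  refine ⟨J, π, fun y ↦ ?_, fun y ↦ ?_, ?_, fun x ↦ ?_, ?_, ?_⟩
  · ext k
    simp [hπ, hJ, inner_sum, inner_smul_right, hbb]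
  · simp [hJ, ← hb0, inner_sum, inner_smul_right, hbb, (Fin.succ_ne_zero _).symm]
  · ext k
    simp [hπ, ← hb0, hbb]
  · have := b.sum_repr' x
    rw [Fin.sum_univ_succ, hb0] at this
    rw [hJ]
    simpa [hπ] using this
  · refine LipschitzWith.of_dist_le_mul fun x y ↦ ?_
    rw [dist_eq_norm, dist_eq_norm, ← map_sub, NNReal.coe_one, one_mul,
      pi_norm_le_iff_of_nonneg (norm_nonneg _)]
    intro k
    rw [hπ, Real.norm_eq_abs]
    simpa using abs_real_inner_le_norm (b k.succ) (x - y)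
  · have h1 := (volume_preserving_piFinSuccAbove (fun _ : Fin (n + 1) ↦ ℝ) 0).symm
    have h2 := PiLp.volume_preserving_toLp (Fin (n + 1))
    have h3 := b.measurePreserving_repr_symm
    have h4 := (h3.comp (h2.comp h1)).comp
      (Measure.measurePreserving_swap (μ := (volume : Measure (Fin n → ℝ)))
        (ν := (volume : Measure ℝ)))
    convert h4 using 1
    ext1 p
    simp only [Function.comp_apply, Prod.swap]
    rw [← b.sum_repr_symm, Fin.sum_univ_succ, hb0, hJ]
    simp [MeasurableEquiv.piFinSuccAbove]

/-- Divergence theorem in the half-space `{t < 0}` for the field `(c, m y)`, which does not depend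
on the normal variable `t`: the tangential part `c` contributes nothing, and the normal part only
the boundary values of `Z`. -/
lemma integral_halfSpace_fderiv_eq {n : ℕ} {Z : (Fin n → ℝ) × ℝ → ℝ} (hZ : ContDiff ℝ 1 Z)
    (hZc : HasCompactSupport Z) (c : Fin n → ℝ) {m : (Fin n → ℝ) → ℝ} (hm : Continuous m) :
    ∫ p in {p : (Fin n → ℝ) × ℝ | p.2 < 0}, fderiv ℝ Z p (c, m p.1) = ∫ y, m y * Z (y, 0) := by
  have hS : MeasurableSet {p : (Fin n → ℝ) × ℝ | p.2 < 0} :=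
    measurableSet_lt measurable_snd measurable_const
  have hcont : Continuous (fderiv ℝ Z) := hZ.continuous_fderiv one_ne_zero
  have hcs : HasCompactSupport (fderiv ℝ Z) := hZc.fderiv ℝ
  have hi1 : Integrable (fun p ↦ fderiv ℝ Z p (c, 0)) (volume.prod volume) :=
    (hcont.clm_apply continuous_const).integrable_of_hasCompactSupport
      (hcs.mono fun p hp h ↦ hp (by simp [h]))
  have hi2 : Integrable (fun p ↦ fderiv ℝ Z p (0, m p.1)) (volume.prod volume) :=
    (hcont.clm_apply (by fun_prop)).integrable_of_hasCompactSupport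
      (hcs.mono fun p hp h ↦ hp (by simp [h]))
  have hsplit : ∀ p : (Fin n → ℝ) × ℝ, fderiv ℝ Z p (c, m p.1) =
      fderiv ℝ Z p (c, 0) + fderiv ℝ Z p (0, m p.1) := fun p ↦ by
    rw [← map_add]; simp
  simp_rw [hsplit]
  change ∫ p in _, _ ∂(volume.prod volume) = _
  rw [integral_add hi1.integrableOn hi2.integrableOn]
  have hdiff : Differentiable ℝ Z := hZ.differentiable one_ne_zero
  have h1 : ∫ p in {p : (Fin n → ℝ) × ℝ | p.2 < 0}, fderiv ℝ Z p (c, 0) ∂(volume.prod volume)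
      = 0 := by
    rw [← integral_indicator hS, integral_prod_symm _ (hi1.indicator hS)]
    refine integral_eq_zero_of_ae (ae_of_all _ fun t ↦ ?_)
    simp only [Pi.zero_apply]
    by_cases ht : t < 0
    · have hd : ∀ y : Fin n → ℝ, fderiv ℝ (fun y ↦ Z (y, t)) y c = fderiv ℝ Z (y, t) (c, 0) := by
        intro y
        have : HasFDerivAt (fun y : Fin n → ℝ ↦ Z (y, t)) _ y :=
          (hdiff (y, t)).hasFDerivAt.comp y (hasFDerivAt_prodMk_left y t)
        rw [this.fderiv]; simp
      have hcs' : HasCompactSupport (fun y : Fin n → ℝ ↦ Z (y, t)) := by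
        refine HasCompactSupport.of_support_subset_isCompact
          (hZc.isCompact.image continuous_fst) fun y hy ↦ ?_
        exact ⟨(y, t), subset_tsupport _ hy, rfl⟩
      have hsm : ContDiff ℝ 1 (fun y : Fin n → ℝ ↦ Z (y, t)) := by fun_prop
      have := integral_mul_fderiv_eq_neg_fderiv_mul_of_integrable (μ := volume)
        (f := fun _ : Fin n → ℝ ↦ (1 : ℝ)) (g := fun y ↦ Z (y, t)) (v := c) (by simp)
        (by
          simpa using ((hsm.continuous_fderiv one_ne_zero).clm_apply
            continuous_const).integrable_of_hasCompactSupport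
            ((hcs'.fderiv ℝ).mono fun p hp h ↦ hp (by simp [h])))
        (by simpa using hsm.continuous.integrable_of_hasCompactSupport hcs') (by simp)
        (fun x _ ↦ (hsm.differentiable one_ne_zero) x)
      simpa [indicator, ht, hd] using this
    · simp [indicator, ht]
  rw [h1, zero_add, ← integral_indicator hS, integral_prod _ (hi2.indicator hS)]
  refine integral_congr_ae (ae_of_all _ fun y ↦ ?_)
  have hind : ∀ t : ℝ, {p : (Fin n → ℝ) × ℝ | p.2 < 0}.indicator
      (fun p ↦ fderiv ℝ Z p (0, m p.1)) (y, t) =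
      (Iio (0 : ℝ)).indicator (fun t ↦ m y * fderiv ℝ Z (y, t) (0, 1)) t := by
    intro t
    by_cases ht : t < 0
    · have : ((0, m y) : (Fin n → ℝ) × ℝ) = m y • ((0, 1) : (Fin n → ℝ) × ℝ) := by simp
      simp only [indicator, mem_ofPred_eq, ht, if_true, mem_Iio]
      rw [this, map_smul, smul_eq_mul]
    · simp [indicator, ht]
  simp_rw [hind]
  rw [integral_indicator measurableSet_Iio, integral_const_mul, ← integral_Iic_eq_integral_Iio]
  congr 1
  have hcs' : HasCompactSupport (fun t : ℝ ↦ Z (y, t)) := by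
    refine HasCompactSupport.of_support_subset_isCompact
      (hZc.isCompact.image continuous_snd) fun t ht ↦ ?_
    exact ⟨(y, t), subset_tsupport _ ht, rfl⟩
  have hd : ∀ t : ℝ, HasDerivAt (fun t ↦ Z (y, t)) (fderiv ℝ Z (y, t) (0, 1)) t := by
    intro t
    have : HasFDerivAt (fun t : ℝ ↦ Z (y, t)) _ t :=
      (hdiff (y, t)).hasFDerivAt.comp t (hasFDerivAt_prodMk_right y t)
    simpa using this.hasDerivAt
  have hlim : Tendsto (fun t : ℝ ↦ Z (y, t)) atBot (𝓝 0) := by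
    obtain ⟨B, hB⟩ := hcs'.isCompact.bddBelow
    refine tendsto_const_nhds.congr' ?_
    filter_upwards [eventually_lt_atBot B] with t ht
    by_contra h
    exact absurd (hB (subset_tsupport _ (Ne.symm h))) (not_le.mpr ht)
  rw [integral_Iic_of_hasDerivAt_of_tendsto (f := fun t ↦ Z (y, t)) (m := 0)
    (hd 0).continuousAt.continuousWithinAt (fun t _ ↦ hd t) _ hlim, sub_zero]
  refine Integrable.integrableOn ?_
  refine Continuous.integrable_of_hasCompactSupport (by fun_prop) ?_
  refine HasCompactSupport.of_support_subset_isCompact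
      (hcs.isCompact.image continuous_snd) fun t ht ↦ ?_
  exact ⟨(y, t), subset_tsupport _ fun h ↦ ht (by simp [h]), rfl⟩

/-! ### A surface bound for integrals of derivatives -/

/-- The surface bound in a boundary chart. The shear `(y, t) ↦ (t + γ(Jy)) ν + Jy` flattens the
boundary and preserves volume; it turns `∂ᵢ` into a derivative along `(c, m y)`, where `m` is bounded
on the chart. The boundary integral over the flattened variable `y` is controlled by the Hausdorff
measure because the projection onto `y` is `1`-Lipschitz for the sup norm, and the top-dimensional
Hausdorff measure of that norm is the volume. -/
lemma exists_measure_enorm_integral_pderiv_le_of_graph {n : ℕ} {Ω : Opens (Euc (n + 1))}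
    {x₀ ν : Euc (n + 1)} {r : ℝ} {γ : Euc (n + 1) → ℝ} (hν : ‖ν‖ = 1)
    (hγ : ContDiff ℝ (⊤ : ℕ∞) γ) (hinv : ∀ x (t : ℝ), γ (x + t • ν) = γ x)
    (hΩ : (Ω : Set (Euc (n + 1))) ∩ ball x₀ r = {x ∈ ball x₀ r | ⟪ν, x⟫ < γ x}) :
    ∃ μ : Measure (Euc (n + 1)), IsFiniteMeasure μ ∧
      (∃ C : ℝ≥0∞, C ≠ ∞ ∧ μ ≤ C • surfaceMeasure Ω) ∧
      ∀ ζ : Euc (n + 1) → ℝ, ContDiff ℝ 1 ζ → tsupport ζ ⊆ ball x₀ r →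
        ∀ i, ‖∫ x in (Ω : Set (Euc (n + 1))), pderiv i ζ x‖ₑ ≤ ∫⁻ x, ‖ζ x‖ₑ ∂μ := by
  obtain ⟨J, π, hπJ, hνJ, hπν, hdec, hπL, hmp⟩ := exists_coordinates hν
  have hγc : Continuous γ := hγ.continuous
  have hνν : ⟪ν, ν⟫ = 1 := by rw [real_inner_self_eq_norm_sq, hν]; norm_num
  set σ : (Fin n → ℝ) → Euc (n + 1) := fun y ↦ γ (J y) • ν + J y with hσ
  have hσc : Continuous σ := by fun_prop
  have hπσ : ∀ y, π (σ y) = y := fun y ↦ by simp [hσ, hπν, hπJ]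
  have hγJ : ∀ (s : ℝ) y, γ (s • ν + J y) = γ (J y) := fun s y ↦ by rw [add_comm, hinv]
  set A : Set (Fin n → ℝ) := σ ⁻¹' ball x₀ r with hA
  have hAm : MeasurableSet A := (isOpen_ball.preimage hσc).measurableSet
  have hKc : IsCompact (π '' closedBall x₀ r) :=
    (isCompact_closedBall x₀ r).image π.continuous
  have hAK : A ⊆ π '' closedBall x₀ r := fun y hy ↦ ⟨σ y, ball_subset_closedBall hy, hπσ y⟩
  have hAfin : volume A < ∞ := (measure_mono hAK).trans_lt hKc.measure_lt_top
  -- a bound for the slopes of the graph over the chart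
  have hmc : ∀ v : Euc (n + 1), Continuous
      fun y ↦ ⟪ν, v⟫ - fderiv ℝ γ (J y) (J (π v)) := fun v ↦ by
    have : Continuous (fderiv ℝ γ) := hγ.continuous_fderiv (by simp)
    fun_prop
  have hM : ∃ M : NNReal, ∀ (i : Fin (n + 1)), ∀ y ∈ A,
      ‖⟪ν, EuclideanSpace.single i (1 : ℝ)⟫ -
        fderiv ℝ γ (J y) (J (π (EuclideanSpace.single i 1)))‖ₑ ≤ M := by
    have := fun i : Fin (n + 1) ↦ hKc.exists_bound_of_continuousOn
      (hmc (EuclideanSpace.single i 1)).continuousOn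
    choose M hM using this
    refine ⟨∑ i, (M i).toNNReal, fun i y hy ↦ ?_⟩
    rw [← enorm_norm, Real.enorm_eq_ofReal (norm_nonneg _)]
    refine (ENNReal.ofReal_le_ofReal (hM i y (hAK hy))).trans ?_
    rw [ENNReal.ofReal, ENNReal.coe_le_coe]
    exact Finset.single_le_sum (f := fun i ↦ (M i).toNNReal) (fun _ _ ↦ zero_le) (Finset.mem_univ i)
  obtain ⟨M, hM⟩ := hM
  -- points of the graph in the chart are boundary points
  have hfr : ∀ y ∈ A, σ y ∈ frontier (Ω : Set (Euc (n + 1))) := by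
    intro y hy
    have hinσ : ⟪ν, σ y⟫ = γ (J y) := by simp [hσ, inner_add_right, inner_smul_right, hν, hνJ]
    rw [Ω.isOpen.frontier_eq]
    refine ⟨?_, fun h ↦ ?_⟩
    · have hcl : Tendsto (fun t : ℝ ↦ σ y + t • ν) (𝓝[<] 0) (𝓝 (σ y)) := by
        have : Continuous fun t : ℝ ↦ σ y + t • ν := by fun_prop
        exact (by simpa using this.tendsto 0 : Tendsto _ (𝓝 (0 : ℝ)) (𝓝 (σ y))).mono_left
          nhdsWithin_le_nhds
      refine mem_closure_of_tendsto hcl ?_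
      filter_upwards [hcl (isOpen_ball.mem_nhds hy), self_mem_nhdsWithin] with t ht1 ht2
      have : σ y + t • ν ∈ {x ∈ ball x₀ r | ⟪ν, x⟫ < γ x} := by
        refine ⟨ht1, ?_⟩
        rw [hinv, inner_add_right, inner_smul_right, hνν, hinσ, mul_one]
        simp only [hσ, hγJ]
        have : t < 0 := ht2
        linarith
      rw [← hΩ] at this
      exact this.1
    · have : σ y ∈ {x ∈ ball x₀ r | ⟪ν, x⟫ < γ x} := hΩ ▸ ⟨h, hy⟩
      have h2 := this.2
      rw [hinσ] at h2
      simp only [hσ, hγJ, lt_self_iff_false] at h2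
  have hle : Measure.map σ (volume.restrict A) ≤ surfaceMeasure Ω := by
    refine Measure.le_iff.mpr fun B hB ↦ ?_
    rw [Measure.map_apply hσc.measurable hB, Measure.restrict_apply (hσc.measurable hB),
      surfaceMeasure, Measure.restrict_apply hB, ← hausdorffMeasure_pi_real]
    have himg : σ ⁻¹' B ∩ A ⊆ π '' (σ '' (σ ⁻¹' B ∩ A)) := fun y hy ↦
      ⟨σ y, ⟨y, hy, rfl⟩, hπσ y⟩
    refine (measure_mono himg).trans ((hπL.lipschitzOnWith.hausdorffMeasure_image_le
      (by positivity)).trans ?_)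
    simp only [ENNReal.coe_one, ENNReal.one_rpow, one_mul, Fintype.card_fin, Nat.cast_add,
      Nat.cast_one, add_sub_cancel_right]
    refine measure_mono ?_
    rintro _ ⟨y, hy, rfl⟩
    exact ⟨hy.1, hfr y hy.2⟩
  refine ⟨(M : ℝ≥0∞) • Measure.map σ (volume.restrict A), ?_, ⟨M, ENNReal.coe_ne_top, ?_⟩, ?_⟩
  · have : IsFiniteMeasure (volume.restrict A) := ⟨by simpa using hAfin⟩
    exact Measure.smul_finite _ ENNReal.coe_ne_top
  · exact Measure.le_iff.mpr fun B _ ↦ mul_le_mul_right (hle B) _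
  intro ζ hζ hsupp i
  set v : Euc (n + 1) := EuclideanSpace.single i 1 with hv
  -- coordinates which flatten the boundary
  set Ψ : (Fin n → ℝ) × ℝ → Euc (n + 1) := fun p ↦ (p.2 + γ (J p.1)) • ν + J p.1 with hΨ
  have hΨmp : MeasurePreserving Ψ (volume.prod volume) volume := by
    have hsh : MeasurePreserving (fun p : (Fin n → ℝ) × ℝ ↦ (p.1, p.2 + γ (J p.1)))
        (volume.prod volume) (volume.prod volume) := by
      refine (MeasurePreserving.id volume).skew_product
        (g := fun (y : Fin n → ℝ) (t : ℝ) ↦ t + γ (J y)) ?_ (ae_of_all _ fun y ↦ ?_)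
      · refine Continuous.measurable ?_
        simp only [Function.uncurry_def]
        fun_prop
      · exact (measurePreserving_add_right volume (γ (J y))).map_eq
    exact hmp.comp hsh
  have hΨs : ContDiff ℝ 1 Ψ := by
    have : ContDiff ℝ 1 γ := hγ.of_le (by simp)
    fun_prop
  have hζc : HasCompactSupport ζ :=
    (isCompact_closedBall x₀ r).of_isClosed_subset (isClosed_tsupport _)
      (hsupp.trans ball_subset_closedBall)
  set Z := ζ ∘ Ψ with hZ
  have hZs : ContDiff ℝ 1 Z := hζ.comp hΨs
  have hZc : HasCompactSupport Z := by
    have hinvΨ : ∀ p, (π (Ψ p), ⟪ν, Ψ p⟫ - γ (J (π (Ψ p)))) = p := fun p ↦ by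
      have h1 : π (Ψ p) = p.1 := by simp [hΨ, hπν, hπJ]
      rw [h1]
      ext
      · rfl
      · simp [hΨ, inner_add_right, inner_smul_right, hν, hνJ]
    refine HasCompactSupport.of_support_subset_isCompact
      (hζc.isCompact.image (f := fun x ↦ (π x, ⟪ν, x⟫ - γ (J (π x)))) (by fun_prop)) fun p hp ↦ ?_
    exact ⟨Ψ p, subset_tsupport _ hp, hinvΨ p⟩
  set m : (Fin n → ℝ) → ℝ := fun y ↦ ⟪ν, v⟫ - fderiv ℝ γ (J y) (J (π v)) with hm
  have hchain : ∀ p, fderiv ℝ Z p (π v, m p.1) = pderiv i ζ (Ψ p) := by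
    intro p
    have hγd : DifferentiableAt ℝ γ (J p.1) := hγ.differentiable (by simp) _
    have h1 : HasFDerivAt (fun p : (Fin n → ℝ) × ℝ ↦ γ (J p.1))
        ((fderiv ℝ γ (J p.1)).comp (J.comp (ContinuousLinearMap.fst ℝ _ ℝ))) p :=
      hγd.hasFDerivAt.comp p (J.comp (ContinuousLinearMap.fst ℝ _ ℝ)).hasFDerivAt
    have h2 : HasFDerivAt Ψ _ p :=
      ((hasFDerivAt_snd.add h1).smul_const ν).add
        (J.comp (ContinuousLinearMap.fst ℝ _ ℝ)).hasFDerivAt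
    have h3 : HasFDerivAt Z _ p := ((hζ.differentiable one_ne_zero) (Ψ p)).hasFDerivAt.comp p h2
    rw [h3.fderiv, pderiv]
    simp only [ContinuousLinearMap.comp_apply]
    congr 1
    conv_rhs => rw [← hv, ← hdec v]
    simp [hm]
  have hD : ∫ x in (Ω : Set (Euc (n + 1))), pderiv i ζ x =
      ∫ p in {p : (Fin n → ℝ) × ℝ | p.2 < 0}, fderiv ℝ Z p (π v, m p.1) := by
    have hS : MeasurableSet {p : (Fin n → ℝ) × ℝ | p.2 < 0} :=
      measurableSet_lt measurable_snd measurable_const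
    rw [← integral_indicator Ω.isOpen.measurableSet, ← integral_indicator hS, ← hΨmp.map_eq,
      integral_map hΨmp.measurable.aemeasurable]
    · refine integral_congr_ae (ae_of_all _ fun p ↦ ?_)
      simp only [indicator, mem_ofPred_eq, hchain]
      by_cases hb : Ψ p ∈ ball x₀ r
      · have : Ψ p ∈ (Ω : Set (Euc (n + 1))) ↔ p.2 < 0 := by
          have h1 : Ψ p ∈ (Ω : Set (Euc (n + 1))) ∩ ball x₀ r ↔
            Ψ p ∈ {x ∈ ball x₀ r | ⟪ν, x⟫ < γ x} := by rw [hΩ]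
          have h2 : γ (Ψ p) = γ (J p.1) := hγJ _ _
          have h3 : ⟪ν, Ψ p⟫ = p.2 + γ (J p.1) := by
            simp [hΨ, inner_add_right, inner_smul_right, hν, hνJ]
          simpa [mem_ball.mp hb, h2, h3] using h1
        simp only [this]
      · have h0 : pderiv i ζ (Ψ p) = 0 := by
          rw [pderiv, fderiv_of_notMem_tsupport ℝ (fun h ↦ hb (hsupp h))]; rfl
        simp [h0]
    · rw [hΨmp.map_eq]
      refine AEStronglyMeasurable.indicator ?_ Ω.isOpen.measurableSet
      exact ((hζ.continuous_fderiv one_ne_zero).clm_apply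
        continuous_const).aestronglyMeasurable
  rw [hD, integral_halfSpace_fderiv_eq hZs hZc (π v) (hmc v)]
  refine (enorm_integral_le_lintegral_enorm _).trans ?_
  rw [lintegral_smul_measure, lintegral_map hζ.continuous.enorm.measurable hσc.measurable, smul_eq_mul,
    ← lintegral_const_mul' _ _ ENNReal.coe_ne_top, ← lintegral_indicator hAm]
  refine lintegral_mono fun y ↦ ?_
  have hZσ : Z (y, 0) = ζ (σ y) := by simp [hZ, hΨ, hσ]
  by_cases hy : y ∈ A
  · simp only [indicator, hy, if_true, enorm_mul, hZσ]
    gcongr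
    exact hM i y hy
  · have : ζ (σ y) = 0 := by
      by_contra h
      exact hy (hsupp (subset_tsupport _ h))
    simp [hZσ, this]

/-- A finite smooth partition of unity on a compact set. -/
lemma exists_smooth_partition {E : Type*} [NormedAddCommGroup E] [NormedSpace ℝ E]
    [FiniteDimensional ℝ E] {K : Set E} (hK : IsCompact K) (ρ : E → ℝ) (hρ : ∀ x ∈ K, 0 < ρ x) :
    ∃ (s : Finset E) (χ : s → E → ℝ), (∀ j : s, (j : E) ∈ K ∧ ContDiff ℝ (⊤ : ℕ∞) (χ j) ∧
      (∀ x, χ j x ∈ Icc 0 1) ∧ tsupport (χ j) ⊆ ball (j : E) (ρ j)) ∧ ∀ x ∈ K, ∑ j, χ j x = 1 := by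
  obtain ⟨s, hsK, hs⟩ := hK.elim_nhds_subcover (fun x ↦ ball x (ρ x))
    fun x hx ↦ ball_mem_nhds x (hρ x hx)
  obtain ⟨f, hf⟩ := SmoothPartitionOfUnity.exists_isSubordinate (modelWithCornersSelf ℝ E)
    hK.isClosed (fun j : s ↦ ball (j : E) (ρ j)) (fun _ ↦ isOpen_ball)
    (by simpa [iUnion_subtype] using hs)
  refine ⟨s, fun j ↦ f j, fun j ↦ ⟨hsK j j.2, (f j).contMDiff.contDiff, fun x ↦
    ⟨f.nonneg j x, f.le_one j x⟩, hf j⟩,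
    fun x hx ↦ ?_⟩
  rw [← finsum_eq_sum_of_fintype]
  exact f.sum_eq_one hx

/-- Near each point of its closure, a domain with smooth boundary can be pushed inside itself by
small translations in a fixed direction `-ν` (with `ν = 0` near interior points). -/
lemma HasSmoothBoundary.exists_shift {N : ℕ} {Ω : Opens (Euc N)} (hΩ : HasSmoothBoundary Ω)
    {x₀ : Euc N} (hx₀ : x₀ ∈ closure (Ω : Set (Euc N))) :
    ∃ (ρ : ℝ) (ν : Euc N), 0 < ρ ∧ ∀ t ∈ Ioo 0 ρ,
      ∀ z ∈ closure (Ω : Set (Euc N)) ∩ closedBall x₀ ρ, z - t • ν ∈ Ω := by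
  by_cases h : x₀ ∈ Ω
  · obtain ⟨ε, hε, hb⟩ := Metric.isOpen_iff.mp Ω.isOpen x₀ h
    refine ⟨ε / 2, 0, by positivity, fun t _ z hz ↦ ?_⟩
    rw [smul_zero, sub_zero]
    exact hb (closedBall_subset_ball (by linarith) hz.2)
  · obtain ⟨r, ν, γ, hr, hν, hγ, hinv, hΩ⟩ := hΩ x₀ (by rw [Ω.isOpen.frontier_eq]; exact ⟨hx₀, h⟩)
    refine ⟨r / 2, ν, by positivity, fun t ht z hz ↦ ?_⟩
    have hzb : z ∈ ball x₀ r := closedBall_subset_ball (by linarith) hz.2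
    have hzγ : ⟪ν, z⟫ ≤ γ z := by
      have h1 : z ∈ closure ((Ω : Set (Euc N)) ∩ ball x₀ r) := by
        rw [inter_comm]
        exact isOpen_ball.inter_closure ⟨hzb, hz.1⟩
      have h2 : IsClosed {x : Euc N | ⟪ν, x⟫ ≤ γ x} :=
        isClosed_le (by fun_prop) hγ.continuous
      refine closure_minimal (fun x hx ↦ ?_) h2 h1
      rw [hΩ] at hx
      exact hx.2.le
    have hνν : ⟪ν, ν⟫ = 1 := by rw [real_inner_self_eq_norm_sq, hν]; norm_num
    have : z - t • ν ∈ {x ∈ ball x₀ r | ⟪ν, x⟫ < γ x} := by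
      refine ⟨?_, ?_⟩
      · have h2 := hz.2
        rw [mem_closedBall, dist_eq_norm] at h2
        rw [mem_ball, dist_eq_norm, sub_right_comm]
        refine (norm_sub_le _ _).trans_lt ?_
        rw [norm_smul, hν, Real.norm_of_nonneg ht.1.le]
        linarith [ht.2]
      · rw [sub_eq_add_neg, ← neg_smul, hinv, inner_add_right, inner_smul_right, hνν]
        linarith [ht.1]
    rw [← hΩ] at this
    exact this.1

/-- A one-sided divergence theorem: `|∫_Ω ∂ᵢζ|` is bounded by the integral of `|ζ|` for a finite
measure dominated by a multiple of the surface measure. No normal vector is needed, and the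
finiteness of `μ` spares a proof that the surface measure itself is finite. -/
lemma IsSmoothBoundedDomain.exists_measure_enorm_integral_pderiv_le {N : ℕ} (hN : 1 ≤ N)
    {Ω : Opens (Euc N)} (hΩ : IsSmoothBoundedDomain Ω) :
    ∃ μ : Measure (Euc N), IsFiniteMeasure μ ∧
      (∃ C : ℝ≥0∞, C ≠ ∞ ∧ μ ≤ C • surfaceMeasure Ω) ∧
      ∀ ζ : Euc N → ℝ, ContDiff ℝ 1 ζ →
        ∀ i, ‖∫ x in (Ω : Set (Euc N)), pderiv i ζ x‖ₑ ≤ ∫⁻ x, ‖ζ x‖ₑ ∂μ := by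
  obtain ⟨n, rfl⟩ := Nat.exists_eq_add_of_le' hN
  have hK : IsCompact (closure (Ω : Set (Euc (n + 1)))) := hΩ.2.1.isCompact_closure
  have hloc : ∀ x₀ ∈ closure (Ω : Set (Euc (n + 1))), ∃ r : ℝ, 0 < r ∧
      ∃ μ : Measure (Euc (n + 1)), IsFiniteMeasure μ ∧
      (∃ C : ℝ≥0∞, C ≠ ∞ ∧ μ ≤ C • surfaceMeasure Ω) ∧
      ∀ ζ : Euc (n + 1) → ℝ, ContDiff ℝ 1 ζ → tsupport ζ ⊆ ball x₀ r →
        ∀ i, ‖∫ x in (Ω : Set (Euc (n + 1))), pderiv i ζ x‖ₑ ≤ ∫⁻ x, ‖ζ x‖ₑ ∂μ := by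
    intro x₀ hx₀
    by_cases h : x₀ ∈ Ω
    · obtain ⟨r, hr, hb⟩ := Metric.isOpen_iff.mp Ω.isOpen x₀ h
      refine ⟨r, hr, 0, inferInstance, ⟨0, ENNReal.zero_ne_top, by simp⟩, fun ζ hζ hsupp i ↦ ?_⟩
      have hζc : HasCompactSupport ζ :=
        (isCompact_closedBall x₀ r).of_isClosed_subset (isClosed_tsupport _)
          (hsupp.trans ball_subset_closedBall)
      have h1 : ∫ x in (Ω : Set (Euc (n + 1))), pderiv i ζ x = ∫ x, pderiv i ζ x := by
        refine setIntegral_eq_integral_of_forall_compl_eq_zero fun x hx ↦ ?_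
        rw [pderiv, fderiv_of_notMem_tsupport ℝ (fun h ↦ hx (hb (hsupp h)))]; rfl
      have h2 := integral_mul_fderiv_eq_neg_fderiv_mul_of_integrable (μ := volume)
        (f := fun _ : Euc (n + 1) ↦ (1 : ℝ)) (g := ζ) (v := EuclideanSpace.single i 1) (by simp)
        (by
          simpa using ((hζ.continuous_fderiv one_ne_zero).clm_apply
            continuous_const).integrable_of_hasCompactSupport
            ((hζc.fderiv ℝ).mono fun p hp h ↦ hp (by simp [h])))
        (by simpa using hζ.continuous.integrable_of_hasCompactSupport hζc) (by simp)
        (fun x _ ↦ (hζ.differentiable one_ne_zero) x)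
      rw [h1]
      simpa [pderiv] using h2
    · obtain ⟨r, ν, γ, hr, hν, hγ, hinv, hΩ'⟩ :=
        hΩ.2.2 x₀ (by rw [Ω.isOpen.frontier_eq]; exact ⟨hx₀, h⟩)
      exact ⟨r, hr, exists_measure_enorm_integral_pderiv_le_of_graph hν hγ hinv hΩ'⟩
  choose! ρ hρ μ hμfin hμle hμ using hloc
  obtain ⟨s, χ, hχ, hsum⟩ := exists_smooth_partition hK ρ hρ
  refine ⟨∑ j : s, μ j, ?_, ?_, fun ζ hζ i ↦ ?_⟩
  · have : ∀ j : s, IsFiniteMeasure (μ j) := fun j ↦ hμfin j (hχ j).1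
    exact ⟨by simp [Measure.finsetSum_apply, measure_lt_top]⟩
  · choose! C hC hle using hμle
    refine ⟨∑ j : s, C j,
      (ENNReal.sum_lt_top.mpr fun (j : s) _ ↦ (hC j (hχ j).1).lt_top).ne, ?_⟩
    rw [Finset.sum_smul]
    exact Finset.sum_le_sum fun (j : s) _ ↦ hle j (hχ j).1
  · have hcd : ∀ j : s, ContDiff ℝ 1 (fun x ↦ χ j x * ζ x) := fun j ↦
      ((hχ j).2.1.of_le (by simp)).mul hζ
    have hint : ∀ j : s, IntegrableOn (pderiv i (fun x ↦ χ j x * ζ x)) Ω := fun j ↦ by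
      have : Continuous (pderiv i (fun x ↦ χ j x * ζ x)) :=
        ((hcd j).continuous_fderiv one_ne_zero).clm_apply continuous_const
      exact (this.continuousOn.integrableOn_compact hK).mono_set subset_closure
    have h1 : ∫ x in (Ω : Set (Euc (n + 1))), pderiv i ζ x =
        ∑ j : s, ∫ x in (Ω : Set (Euc (n + 1))), pderiv i (fun x ↦ χ j x * ζ x) x := by
      rw [← integral_finsetSum _ fun j _ ↦ hint j]
      refine setIntegral_congr_fun Ω.isOpen.measurableSet fun x hx ↦ ?_
      have h2 : ζ =ᶠ[𝓝 x] fun x ↦ ∑ j, χ j x * ζ x := by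
        filter_upwards [Ω.isOpen.mem_nhds hx] with z hz
        rw [← Finset.sum_mul, hsum z (subset_closure hz), one_mul]
      simp only [pderiv]
      rw [h2.fderiv_eq, fderiv_fun_sum fun j _ ↦ (hcd j).differentiable one_ne_zero x]
      simp
    rw [h1, lintegral_finsetSum_measure]
    refine (enorm_sum_le _ _).trans (Finset.sum_le_sum fun j _ ↦ ?_)
    refine (hμ j (hχ j).1 _ (hcd j) ((tsupport_mul_subset_left).trans (hχ j).2.2.2) i).trans ?_
    refine lintegral_mono fun x ↦ ?_
    rw [enorm_mul]
    refine mul_le_of_le_one_left' ?_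
    rw [Real.enorm_eq_ofReal ((hχ j).2.2.1 x).1]
    exact ENNReal.ofReal_le_one.mpr ((hχ j).2.2.1 x).2

/-! ### Convergence in `L²` -/

section L2

variable {α F : Type*} {m : MeasurableSpace α} {μ : Measure α} [NormedAddCommGroup F]

lemma tendsto_eLpNorm_two_of_dominated {f : ℕ → α → F} {g : α → ℝ} (hg : MemLp g 2 μ)
    (hf : ∀ k, AEStronglyMeasurable (f k) μ) (hfg : ∀ k, ∀ᵐ x ∂μ, ‖f k x‖ ≤ g x)
    (hlim : ∀ᵐ x ∂μ, Tendsto (fun k ↦ f k x) atTop (𝓝 0)) :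
    Tendsto (fun k ↦ eLpNorm (f k) 2 μ) atTop (𝓝 0) := by
  have h2 : ∀ h : α → F, eLpNorm h 2 μ = (∫⁻ x, ‖h x‖ₑ ^ (2 : ℝ) ∂μ) ^ (1 / 2 : ℝ) := fun h ↦ by
    rw [eLpNorm_eq_lintegral_rpow_enorm_toReal two_ne_zero ENNReal.ofNat_ne_top]; simp
  simp_rw [h2]
  have h3 : Tendsto (fun k ↦ ∫⁻ x, ‖f k x‖ₑ ^ (2 : ℝ) ∂μ) atTop (𝓝 (∫⁻ _, 0 ∂μ)) := by
    refine tendsto_lintegral_of_dominated_convergence' (fun x ↦ ‖g x‖ₑ ^ (2 : ℝ))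
      (fun k ↦ (hf k).enorm.pow_const _) (fun k ↦ ?_) ?_ ?_
    · filter_upwards [hfg k] with x hx
      gcongr
      rw [← enorm_norm (f k x)]
      rw [enorm_le_iff_norm_le, norm_norm]
      exact hx.trans (le_abs_self _)
    · have := hg.eLpNorm_lt_top
      rw [eLpNorm_lt_top_iff_lintegral_rpow_enorm_lt_top two_ne_zero ENNReal.ofNat_ne_top] at this
      simpa using this.ne
    · filter_upwards [hlim] with x hx
      have := (hx.enorm.ennrpow_const (2 : ℝ))
      simpa using this
  have h4 := h3.ennrpow_const (1 / 2 : ℝ)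
  simpa using h4

lemma tendsto_integral_mul_of_tendsto_eLpNorm {f g : ℕ → α → ℝ} {f₀ g₀ : α → ℝ}
    (hf : ∀ k, MemLp (f k) 2 μ) (hf₀ : MemLp f₀ 2 μ) (hg : ∀ k, MemLp (g k) 2 μ)
    (hg₀ : MemLp g₀ 2 μ) (hft : Tendsto (fun k ↦ eLpNorm (f k - f₀) 2 μ) atTop (𝓝 0))
    (hgt : Tendsto (fun k ↦ eLpNorm (g k - g₀) 2 μ) atTop (𝓝 0)) :
    Tendsto (fun k ↦ ∫ x, f k x * g k x ∂μ) atTop (𝓝 (∫ x, f₀ x * g₀ x ∂μ)) := by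
  have key : ∀ {a b : α → ℝ} (ha : MemLp a 2 μ) (hb : MemLp b 2 μ),
      ∫ x, a x * b x ∂μ = inner ℝ (ha.toLp a) (hb.toLp b) := by
    intro a b ha hb
    rw [L2.inner_def]
    refine integral_congr_ae ?_
    filter_upwards [ha.coeFn_toLp, hb.coeFn_toLp] with x h1 h2
    rw [h1, h2]
    simp [mul_comm]
  simp_rw [fun k ↦ key (hf k) (hg k), key hf₀ hg₀]
  exact ((Lp.tendsto_Lp_iff_tendsto_eLpNorm'' f hf f₀ hf₀).mpr hft).inner
    ((Lp.tendsto_Lp_iff_tendsto_eLpNorm'' g hg g₀ hg₀).mpr hgt)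

lemma tendsto_eLpNorm_of_le {G : Type*} [NormedAddCommGroup G] {f : ℕ → α → F} {g : ℕ → α → G}
    {p : ℝ≥0∞} (C : ℝ) (h : ∀ k, ∀ᵐ x ∂μ, ‖f k x‖ ≤ C * ‖g k x‖)
    (hg : Tendsto (fun k ↦ eLpNorm (g k) p μ) atTop (𝓝 0)) :
    Tendsto (fun k ↦ eLpNorm (f k) p μ) atTop (𝓝 0) := by
  have h1 := ENNReal.Tendsto.const_mul (a := ENNReal.ofReal C) hg (Or.inr ENNReal.ofReal_ne_top)
  rw [mul_zero] at h1
  exact tendsto_of_tendsto_of_tendsto_of_le_of_le tendsto_const_nhds h1 (fun _ ↦ zero_le)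
    fun k ↦ eLpNorm_le_mul_eLpNorm_of_ae_le_mul (h k) p

end L2

lemma aestronglyMeasurable_clm_apply {α F G : Type*} {m : MeasurableSpace α} {μ : Measure α}
    [NormedAddCommGroup F] [NormedSpace ℝ F] [NormedAddCommGroup G] [NormedSpace ℝ G]
    {A : α → F →L[ℝ] G} {v : α → F} (hA : AEStronglyMeasurable A μ)
    (hv : AEStronglyMeasurable v μ) : AEStronglyMeasurable (fun x ↦ A x (v x)) μ :=
  (continuous_fst.clm_apply continuous_snd : Continuous fun q : (F →L[ℝ] G) × F ↦ q.1 q.2)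
    |>.comp_aestronglyMeasurable (hA.prodMk hv)

lemma memLp_of_continuous {N : ℕ} {F : Type*} [NormedAddCommGroup F] {Ω : Opens (Euc N)}
    (hΩ : Bornology.IsBounded (Ω : Set (Euc N))) {h : Euc N → F} (hh : Continuous h) (p : ℝ≥0∞) :
    MemLp h p (volume.restrict Ω) := by
  have hK := hΩ.isCompact_closure
  obtain ⟨C, hC⟩ := hK.exists_bound_of_continuousOn hh.continuousOn
  have : IsFiniteMeasure (volume.restrict (Ω : Set (Euc N))) :=
    ⟨by simpa using (measure_mono subset_closure).trans_lt hK.measure_lt_top⟩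
  refine MemLp.of_bound hh.aestronglyMeasurable C ?_
  filter_upwards [ae_restrict_mem Ω.isOpen.measurableSet] with x hx
  exact hC x (subset_closure hx)

lemma continuous_pderiv {N : ℕ} {F : Type*} [NormedAddCommGroup F] [NormedSpace ℝ F]
    {φ : Euc N → F} (hφ : ContDiff ℝ 1 φ) (i : Fin N) : Continuous (pderiv i φ) :=
  (hφ.continuous_fderiv one_ne_zero).clm_apply continuous_const

/-- The functions `ψ k`, smooth on all of `ℝᴺ`, converge to `u` in `H¹(Ω)`, the `i`-th partial
derivatives converging to `w i`. This replaces membership in `H¹(Ω)` throughout: it is what the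
definition of the trace provides, and it passes to smooth functions of `u`. -/
structure H1Approx {N : ℕ} {F : Type*} [NormedAddCommGroup F] [NormedSpace ℝ F]
    (Ω : Opens (Euc N)) (u : Euc N → F) (w : Fin N → Euc N → F) (ψ : ℕ → Euc N → F) : Prop where
  contDiff : ∀ k, ContDiff ℝ (⊤ : ℕ∞) (ψ k)
  memLp : MemLp u 2 (volume.restrict Ω)
  memLp_deriv : ∀ i, MemLp (w i) 2 (volume.restrict Ω)
  tendsto : Tendsto (fun k ↦ eLpNorm (ψ k - u) 2 (volume.restrict Ω)) atTop (𝓝 0)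
  tendsto_deriv : ∀ i,
    Tendsto (fun k ↦ eLpNorm (pderiv i (ψ k) - w i) 2 (volume.restrict Ω)) atTop (𝓝 0)

namespace H1Approx

variable {N : ℕ} {F : Type*} [NormedAddCommGroup F] [NormedSpace ℝ F]
    {Ω : Opens (Euc N)} {u : Euc N → F} {w : Fin N → Euc N → F} {ψ : ℕ → Euc N → F}

lemma subseq (h : H1Approx Ω u w ψ) {s : ℕ → ℕ} (hs : StrictMono s) :
    H1Approx Ω u w (fun k ↦ ψ (s k)) :=
  ⟨fun _ ↦ h.contDiff _, h.memLp, h.memLp_deriv, h.tendsto.comp hs.tendsto_atTop,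
    fun i ↦ (h.tendsto_deriv i).comp hs.tendsto_atTop⟩

lemma exists_subseq_tendsto_ae (h : H1Approx Ω u w ψ) :
    ∃ s : ℕ → ℕ, StrictMono s ∧
      ∀ᵐ x ∂(volume.restrict (Ω : Set (Euc N))), Tendsto (fun k ↦ ψ (s k) x) atTop (𝓝 (u x)) :=
  (tendstoInMeasure_of_tendsto_eLpNorm two_ne_zero
    (fun k ↦ (h.contDiff k).continuous.aestronglyMeasurable) h.memLp.1
    h.tendsto).exists_seq_tendsto_ae

lemma sub {u' : Euc N → F} {w' : Fin N → Euc N → F} {ψ' : ℕ → Euc N → F}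
    (h : H1Approx Ω u w ψ) (h' : H1Approx Ω u' w' ψ') :
    H1Approx Ω (u - u') (w - w') (ψ - ψ') := by
  have key : ∀ {a b : ℕ → Euc N → F} {a₀ b₀ : Euc N → F},
      (∀ k, AEStronglyMeasurable (a k - a₀) (volume.restrict (Ω : Set (Euc N)))) →
      (∀ k, AEStronglyMeasurable (b k - b₀) (volume.restrict (Ω : Set (Euc N)))) →
      Tendsto (fun k ↦ eLpNorm (a k - a₀) 2 (volume.restrict Ω)) atTop (𝓝 0) →
      Tendsto (fun k ↦ eLpNorm (b k - b₀) 2 (volume.restrict Ω)) atTop (𝓝 0) →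
      Tendsto (fun k ↦ eLpNorm ((a k - b k) - (a₀ - b₀)) 2 (volume.restrict Ω)) atTop (𝓝 0) := by
    intro a b a₀ b₀ ha hb hat hbt
    have h0 := hat.add hbt
    rw [add_zero] at h0
    refine tendsto_of_tendsto_of_tendsto_of_le_of_le tendsto_const_nhds h0 (fun _ ↦ zero_le)
      fun k ↦ ?_
    have : (a k - b k) - (a₀ - b₀) = (a k - a₀) - (b k - b₀) := by abel
    simp only [this]
    exact eLpNorm_sub_le (ha k) (hb k) (by norm_num)
  have hd := fun k ↦ (h.contDiff k).of_le (m := 1) (by simp)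
  have hd' := fun k ↦ (h'.contDiff k).of_le (m := 1) (by simp)
  refine ⟨fun k ↦ (h.contDiff k).sub (h'.contDiff k), h.memLp.sub h'.memLp,
    fun i ↦ (h.memLp_deriv i).sub (h'.memLp_deriv i), ?_, fun i ↦ ?_⟩
  · exact key (fun k ↦ (h.contDiff k).continuous.aestronglyMeasurable.sub h.memLp.1)
      (fun k ↦ (h'.contDiff k).continuous.aestronglyMeasurable.sub h'.memLp.1) h.tendsto h'.tendsto
  · have := key (fun k ↦ (continuous_pderiv (hd k) i).aestronglyMeasurable.sub (h.memLp_deriv i).1)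
      (fun k ↦ (continuous_pderiv (hd' k) i).aestronglyMeasurable.sub (h'.memLp_deriv i).1)
      (h.tendsto_deriv i) (h'.tendsto_deriv i)
    refine this.congr fun k ↦ ?_
    congr 2
    ext1 x
    simp only [pderiv, Pi.sub_apply]
    rw [fderiv_sub ((hd k).differentiable one_ne_zero x) ((hd' k).differentiable one_ne_zero x)]
    rfl

lemma memLp_seq (h : H1Approx Ω u w ψ) (hΩ : Bornology.IsBounded (Ω : Set (Euc N))) (k : ℕ) :
    MemLp (ψ k) 2 (volume.restrict Ω) :=
  memLp_of_continuous hΩ (h.contDiff k).continuous 2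

lemma memLp_pderiv_seq (h : H1Approx Ω u w ψ) (hΩ : Bornology.IsBounded (Ω : Set (Euc N)))
    (i : Fin N) (k : ℕ) : MemLp (pderiv i (ψ k)) 2 (volume.restrict Ω) :=
  memLp_of_continuous hΩ (continuous_pderiv ((h.contDiff k).of_le (by simp)) i) 2

/-- Chain rule for a smooth function with bounded derivative. In
`p'(ψ k) ∂ᵢψ k - p'(u) w i = p'(ψ k) (∂ᵢψ k - w i) + (p'(ψ k) - p'(u)) w i`
the second term tends to `0` by dominated convergence, whence the pointwise convergence `hae`. -/
lemma comp (h : H1Approx Ω u w ψ) (hΩ : Bornology.IsBounded (Ω : Set (Euc N)))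
    (hae : ∀ᵐ x ∂(volume.restrict (Ω : Set (Euc N))), Tendsto (fun k ↦ ψ k x) atTop (𝓝 (u x)))
    {p : F → ℝ} (hp : ContDiff ℝ (⊤ : ℕ∞) p) {L : ℝ} (hL : ∀ y, ‖fderiv ℝ p y‖ ≤ L) :
    H1Approx Ω (p ∘ u) (fun i x ↦ fderiv ℝ p (u x) (w i x)) (fun k ↦ p ∘ ψ k) := by
  have hpd : Differentiable ℝ p := hp.differentiable (by simp)
  have hpc : Continuous (fderiv ℝ p) := hp.continuous_fderiv (by simp)
  have hlip : ∀ y z, ‖p y - p z‖ ≤ L * ‖y - z‖ := fun y z ↦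
    convex_univ.norm_image_sub_le_of_norm_fderiv_le (fun y _ ↦ hpd y) (fun y _ ↦ hL y)
      (mem_univ z) (mem_univ y)
  have hdm : AEStronglyMeasurable (fun x ↦ fderiv ℝ p (u x)) (volume.restrict (Ω : Set (Euc N))) :=
    hpc.comp_aestronglyMeasurable h.memLp.1
  have hLw : ∀ y v, ‖fderiv ℝ p y v‖ ≤ L * ‖v‖ := fun y v ↦
    ((fderiv ℝ p y).le_opNorm v).trans (by gcongr; exact hL y)
  have hm : ∀ i, AEStronglyMeasurable (fun x ↦ fderiv ℝ p (u x) (w i x))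
      (volume.restrict (Ω : Set (Euc N))) := fun i ↦ aestronglyMeasurable_clm_apply hdm (h.memLp_deriv i).1
  refine ⟨fun k ↦ hp.comp (h.contDiff k), ?_, fun i ↦ ?_, ?_, fun i ↦ ?_⟩
  · have hc : MemLp (fun _ : Euc N ↦ p 0) 2 (volume.restrict Ω) :=
      memLp_of_continuous hΩ continuous_const 2
    refine MemLp.of_le (hc.norm.add (h.memLp.norm.const_mul L))
      (hp.continuous.comp_aestronglyMeasurable h.memLp.1) (ae_of_all _ fun x ↦ ?_)
    have h1 := hlip (u x) 0
    rw [sub_zero] at h1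
    have h2 : ‖p (u x)‖ ≤ ‖p 0‖ + ‖p (u x) - p 0‖ := by
      simpa using norm_add_le (p 0) (p (u x) - p 0)
    exact (h2.trans (by simpa using h1)).trans (le_abs_self _)
  · exact MemLp.of_le_mul (h.memLp_deriv i) (hm i) (ae_of_all _ fun x ↦ hLw _ _)
  · exact tendsto_eLpNorm_of_le L (fun k ↦ ae_of_all _ fun x ↦ hlip _ _) h.tendsto
  · have hcd : ∀ k x, pderiv i (p ∘ ψ k) x = fderiv ℝ p (ψ k x) (pderiv i (ψ k) x) := fun k x ↦ by
      rw [pderiv, fderiv_comp x (hpd _) ((h.contDiff k).differentiable (by simp) x)]; rfl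
    have hA : Tendsto (fun k ↦ eLpNorm (fun x ↦ fderiv ℝ p (ψ k x) (pderiv i (ψ k) x - w i x)) 2
        (volume.restrict Ω)) atTop (𝓝 0) :=
      tendsto_eLpNorm_of_le L (fun k ↦ ae_of_all _ fun x ↦ hLw _ _) (h.tendsto_deriv i)
    have hmk : ∀ k, AEStronglyMeasurable (fun x ↦ fderiv ℝ p (ψ k x))
        (volume.restrict (Ω : Set (Euc N))) := fun k ↦
      (hpc.comp (h.contDiff k).continuous).aestronglyMeasurable
    have hB : Tendsto (fun k ↦ eLpNorm (fun x ↦ (fderiv ℝ p (ψ k x) - fderiv ℝ p (u x)) (w i x)) 2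
        (volume.restrict Ω)) atTop (𝓝 0) := by
      refine tendsto_eLpNorm_two_of_dominated ((h.memLp_deriv i).norm.const_mul (2 * L))
        (fun k ↦ aestronglyMeasurable_clm_apply ((hmk k).sub hdm) (h.memLp_deriv i).1)
        (fun k ↦ ae_of_all _ fun x ↦ ?_) ?_
      · refine ((fderiv ℝ p (ψ k x) - fderiv ℝ p (u x)).le_opNorm _).trans ?_
        gcongr
        refine (norm_sub_le _ _).trans ?_
        linarith [hL (ψ k x), hL (u x)]
      · filter_upwards [hae] with x hx
        have h1 : Tendsto (fun k ↦ fderiv ℝ p (ψ k x) - fderiv ℝ p (u x)) atTop (𝓝 0) := by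
          have := ((hpc.tendsto (u x)).comp hx).sub_const (fderiv ℝ p (u x))
          simpa using this
        have h2 := ((ContinuousLinearMap.apply ℝ ℝ (w i x)).continuous.tendsto 0).comp h1
        simpa [Function.comp_def] using h2
    have h0 := hA.add hB
    rw [add_zero] at h0
    refine tendsto_of_tendsto_of_tendsto_of_le_of_le tendsto_const_nhds h0 (fun _ ↦ zero_le)
      fun k ↦ ?_
    have hd : AEStronglyMeasurable (pderiv i (ψ k)) (volume.restrict (Ω : Set (Euc N))) :=
      (h.memLp_pderiv_seq hΩ i k).1
    refine le_trans (le_of_eq ?_) (eLpNorm_add_le (aestronglyMeasurable_clm_apply (hmk k) (hd.sub (h.memLp_deriv i).1))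
      (aestronglyMeasurable_clm_apply ((hmk k).sub hdm) (h.memLp_deriv i).1) (by norm_num))
    congr 1
    ext1 x
    simp [hcd]

end H1Approx

/-! ### Functions with zero trace -/

lemma ae_frontier_of_le_surfaceMeasure {N : ℕ} {Ω : Opens (Euc N)} {μ : Measure (Euc N)} {C : ℝ≥0∞}
    (h : μ ≤ C • surfaceMeasure Ω) : ∀ᵐ x ∂μ, x ∈ frontier (Ω : Set (Euc N)) := by
  have h1 : ∀ᵐ x ∂(surfaceMeasure Ω), x ∈ frontier (Ω : Set (Euc N)) :=
    ae_restrict_mem isClosed_frontier.measurableSet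
  exact (Measure.absolutelyContinuous_of_le_smul h).ae_le h1

lemma pderiv_mul {N : ℕ} {a b : Euc N → ℝ} (ha : ContDiff ℝ 1 a) (hb : ContDiff ℝ 1 b) (i : Fin N)
    (x : Euc N) : pderiv i (fun x ↦ a x * b x) x = a x * pderiv i b x + b x * pderiv i a x := by
  rw [pderiv, fderiv_fun_mul (ha.differentiable one_ne_zero x) (hb.differentiable one_ne_zero x)]
  simp [pderiv]

namespace H1Approx

variable {N : ℕ} {Ω : Opens (Euc N)} {P : Euc N → ℝ} {G : Fin N → Euc N → ℝ} {Ψ : ℕ → Euc N → ℝ}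

/-- A function with zero trace, extended by zero, is weakly differentiable on `ℝᴺ`: the test
function `φ` need not vanish near `∂Ω`. -/
lemma integral_mul_pderiv (hN : 1 ≤ N) (hΩ : IsSmoothBoundedDomain Ω) (h : H1Approx Ω P G Ψ)
    (htr : Tendsto (fun k ↦ eLpNorm (Ψ k) 2 (surfaceMeasure Ω)) atTop (𝓝 0))
    {φ : Euc N → ℝ} (hφ : ContDiff ℝ 1 φ) (i : Fin N) :
    ∫ x in (Ω : Set (Euc N)), P x * pderiv i φ x = -∫ x in (Ω : Set (Euc N)), G i x * φ x := by
  obtain ⟨μ, hμ, ⟨C, hC, hle⟩, hdiv⟩ := hΩ.exists_measure_enorm_integral_pderiv_le hN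
  have hb := hΩ.2.1
  have hK := hb.isCompact_closure
  have hφ2 := memLp_of_continuous hb hφ.continuous 2
  have hdφ2 := memLp_of_continuous hb (continuous_pderiv hφ i) 2
  have h1 : ∀ k, ContDiff ℝ 1 (Ψ k) := fun k ↦ (h.contDiff k).of_le (by simp)
  have hcst : ∀ a : Euc N → ℝ, Tendsto (fun _ : ℕ ↦ eLpNorm (a - a) 2 (volume.restrict Ω))
      atTop (𝓝 0) := fun a ↦ by simp
  have hA := tendsto_integral_mul_of_tendsto_eLpNorm (h.memLp_seq hb) h.memLp (fun _ ↦ hdφ2) hdφ2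
    h.tendsto (hcst _)
  have hB := tendsto_integral_mul_of_tendsto_eLpNorm (h.memLp_pderiv_seq hb i) (h.memLp_deriv i)
    (fun _ ↦ hφ2) hφ2 (h.tendsto_deriv i) (hcst _)
  have hAB := hA.add hB
  have hsplit : ∀ k, (∫ x in (Ω : Set (Euc N)), Ψ k x * pderiv i φ x) +
      (∫ x in (Ω : Set (Euc N)), pderiv i (Ψ k) x * φ x) =
      ∫ x in (Ω : Set (Euc N)), pderiv i (fun x ↦ Ψ k x * φ x) x := fun k ↦ by
    refine (integral_add ((h.memLp_seq hb k).integrable_mul hdφ2)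
      ((h.memLp_pderiv_seq hb i k).integrable_mul hφ2)).symm.trans ?_
    congr 1
    ext x
    simp only [Pi.mul_apply, pderiv_mul (h1 k) hφ]
    ring
  have h0 : Tendsto (fun k ↦ ∫ x in (Ω : Set (Euc N)), pderiv i (fun x ↦ Ψ k x * φ x) x) atTop
      (𝓝 0) := by
    obtain ⟨B, hB⟩ := hK.exists_bound_of_continuousOn hφ.continuous.continuousOn
    have hφμ : eLpNorm φ 2 μ < ∞ := by
      refine (MemLp.of_bound hφ.continuous.aestronglyMeasurable B ?_).eLpNorm_lt_top
      filter_upwards [ae_frontier_of_le_surfaceMeasure hle] with x hx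
      exact hB x (frontier_subset_closure hx)
    have hΨμ : Tendsto (fun k ↦ eLpNorm (Ψ k) 2 μ) atTop (𝓝 0) := by
      have h2 := ENNReal.Tendsto.const_mul (a := C ^ (1 / (2 : ℝ≥0∞)).toReal) htr
        (Or.inr (ENNReal.rpow_ne_top_of_nonneg (by simp) hC))
      rw [mul_zero] at h2
      refine tendsto_of_tendsto_of_tendsto_of_le_of_le tendsto_const_nhds h2 (fun _ ↦ zero_le)
        fun k ↦ (eLpNorm_mono_measure _ hle).trans ?_
      rw [eLpNorm_smul_measure_of_ne_top ENNReal.ofNat_ne_top, smul_eq_mul]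
    have h3 := ENNReal.Tendsto.mul_const hΨμ (Or.inr hφμ.ne)
    rw [zero_mul] at h3
    rw [tendsto_zero_iff_enorm_tendsto_zero]
    refine tendsto_of_tendsto_of_tendsto_of_le_of_le tendsto_const_nhds h3 (fun _ ↦ zero_le)
        fun k ↦ (hdiv _ ((h1 k).mul hφ) i).trans ?_
    have h4 := eLpNorm_smul_le_mul_eLpNorm (p := 2) (q := 2) (r := 1) (μ := μ)
      (f := φ) (φ := Ψ k) hφ.continuous.aestronglyMeasurable (h1 k).continuous.aestronglyMeasurable
    rwa [eLpNorm_one_eq_lintegral_enorm] at h4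
  linarith [tendsto_nhds_unique (hAB.congr hsplit) h0]

/-- Poincaré's inequality for functions with zero trace. Testing the weak derivative with
`xᵢ Ψ k` and letting `k → ∞` gives `∫ P² = -2 ∫ xᵢ P Gᵢ`. -/
lemma integral_sq_le (hN : 1 ≤ N) (hΩ : IsSmoothBoundedDomain Ω) (h : H1Approx Ω P G Ψ)
    (htr : Tendsto (fun k ↦ eLpNorm (Ψ k) 2 (surfaceMeasure Ω)) atTop (𝓝 0))
    {R : ℝ} (hR : ∀ x ∈ Ω, ‖x‖ ≤ R) (i : Fin N) :
    ∫ x in (Ω : Set (Euc N)), P x ^ 2 ≤ 4 * R ^ 2 * ∫ x in (Ω : Set (Euc N)), G i x ^ 2 := by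
  have hb := hΩ.2.1
  have hxs : ContDiff ℝ 1 (fun x : Euc N ↦ x i) := by fun_prop
  have hx1 : ∀ x : Euc N, pderiv i (fun x : Euc N ↦ x i) x = 1 := fun x ↦ by
    have : (fun x : Euc N ↦ x i) = EuclideanSpace.proj (𝕜 := ℝ) i := rfl
    rw [pderiv, this, ContinuousLinearMap.fderiv]
    simp
  have hxR : ∀ᵐ x ∂(volume.restrict (Ω : Set (Euc N))), ‖x i‖ ≤ R := by
    filter_upwards [ae_restrict_mem Ω.isOpen.measurableSet] with x hx
    exact (PiLp.norm_apply_le x i).trans (hR x hx)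
  have hmul : ∀ {a : Euc N → ℝ}, MemLp a 2 (volume.restrict (Ω : Set (Euc N))) →
      MemLp (fun x ↦ x i * a x) 2 (volume.restrict (Ω : Set (Euc N))) := fun {a} ha ↦ by
    refine MemLp.of_le_mul (c := R) ha (hxs.continuous.aestronglyMeasurable.mul ha.1) ?_
    filter_upwards [hxR] with x hx
    rw [norm_mul]
    gcongr
  have h1 : ∀ k, ContDiff ℝ 1 (Ψ k) := fun k ↦ (h.contDiff k).of_le (by simp)
  have hcst : ∀ a : Euc N → ℝ, Tendsto (fun _ : ℕ ↦ eLpNorm (a - a) 2 (volume.restrict Ω))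
      atTop (𝓝 0) := fun a ↦ by simp
  have hA := tendsto_integral_mul_of_tendsto_eLpNorm (fun _ ↦ h.memLp) h.memLp (h.memLp_seq hb)
    h.memLp (hcst _) h.tendsto
  have hB := tendsto_integral_mul_of_tendsto_eLpNorm (fun _ ↦ hmul h.memLp) (hmul h.memLp)
    (h.memLp_pderiv_seq hb i) (h.memLp_deriv i) (hcst _) (h.tendsto_deriv i)
  have hC := tendsto_integral_mul_of_tendsto_eLpNorm (fun _ ↦ hmul (h.memLp_deriv i))
    (hmul (h.memLp_deriv i)) (h.memLp_seq hb) h.memLp (hcst _) h.tendsto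
  have hid : ∀ k, (∫ x in (Ω : Set (Euc N)), P x * Ψ k x) +
      (∫ x in (Ω : Set (Euc N)), (x i * P x) * pderiv i (Ψ k) x) =
      -∫ x in (Ω : Set (Euc N)), (x i * G i x) * Ψ k x := by
    intro k
    refine (integral_add (h.memLp.integrable_mul (h.memLp_seq hb k))
      ((hmul h.memLp).integrable_mul (h.memLp_pderiv_seq hb i k))).symm.trans ?_
    have := h.integral_mul_pderiv hN hΩ htr (hxs.mul (h1 k)) i
    convert this using 2
    · ext x
      simp only [Pi.mul_apply, pderiv_mul hxs (h1 k), hx1]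
      ring
    · congr 1
      ext x
      ring
  have hlim := tendsto_nhds_unique ((hA.add hB).congr hid) hC.neg
  have hi1 := h.memLp.integrable_sq
  have hi2 := (h.memLp_deriv i).integrable_sq
  have hle : ∫ x in (Ω : Set (Euc N)), -2 * ((x i * P x) * G i x) ≤
      ∫ x in (Ω : Set (Euc N)), (1 / 2 * P x ^ 2 + 2 * R ^ 2 * G i x ^ 2) := by
    refine integral_mono_ae (((hmul h.memLp).integrable_mul (h.memLp_deriv i)).const_mul _)
      ((hi1.const_mul _).add (hi2.const_mul _)) ?_
    filter_upwards [hxR] with x hx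
    have h2 : (x i) ^ 2 ≤ R ^ 2 := by
      rw [← sq_abs]
      exact pow_le_pow_left₀ (abs_nonneg _) hx 2
    nlinarith [sq_nonneg (P x + 2 * (x i * G i x)), mul_le_mul_of_nonneg_right h2 (sq_nonneg (G i x))]
  rw [integral_const_mul, integral_add (hi1.const_mul _) (hi2.const_mul _), integral_const_mul,
    integral_const_mul] at hle
  have e1 : ∫ x in (Ω : Set (Euc N)), P x * P x = ∫ x in (Ω : Set (Euc N)), P x ^ 2 := by
    simp_rw [sq]
  have e2 : ∫ x in (Ω : Set (Euc N)), (x i * G i x) * P x =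
      ∫ x in (Ω : Set (Euc N)), (x i * P x) * G i x := by
    congr 1; ext x; ring
  rw [e1, e2] at hlim
  linarith

end H1Approx

/-! ### Convex functions of a solution -/

lemma integrableOn_of_norm_le_of_isCompact {N : ℕ} {F G : Type*} [NormedAddCommGroup F]
    [NormedAddCommGroup G] {Ω : Opens (Euc N)} {K : Set (Euc N)} (hK : IsCompact K)
    (hKΩ : K ⊆ Ω) {w : Euc N → F} (hw : LocallyIntegrableOn w (Ω : Set (Euc N)))
    {f : Euc N → G} (hf : AEStronglyMeasurable f (volume.restrict (Ω : Set (Euc N)))) (C : ℝ)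
    (hfw : ∀ x, ‖f x‖ ≤ C * ‖w x‖) (hf0 : ∀ x, x ∉ K → f x = 0) :
    IntegrableOn f (Ω : Set (Euc N)) := by
  have h1 : IntegrableOn w K := hw.integrableOn_compact_subset hKΩ hK
  have h2 : IntegrableOn f K := Integrable.mono' (h1.norm.const_mul C)
    (hf.mono_measure (Measure.restrict_mono hKΩ le_rfl)) (ae_of_all _ hfw)
  exact h2.of_forall_sdiff_eq_zero Ω.isOpen.measurableSet fun x hx ↦ hf0 x hx.2

lemma pderiv_eq_zero_of_notMem_tsupport {N : ℕ} {F : Type*} [NormedAddCommGroup F]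
    [NormedSpace ℝ F] {φ : Euc N → F} {x : Euc N} (hx : x ∉ tsupport φ) (i : Fin N) :
    pderiv i φ x = 0 := by
  rw [pderiv, fderiv_of_notMem_tsupport ℝ hx]; rfl

lemma contDiff_pderiv {N : ℕ} {F : Type*} [NormedAddCommGroup F]
    [NormedSpace ℝ F] {φ : Euc N → F} (hφ : ContDiff ℝ (⊤ : ℕ∞) φ) (i : Fin N) :
    ContDiff ℝ (⊤ : ℕ∞) (pderiv i φ) :=
  (hφ.fderiv_right (m := ((⊤ : ℕ∞) : WithTop ℕ∞)) (by simp)).clm_apply contDiff_const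

lemma tsupport_pderiv_subset {N : ℕ} {F : Type*} [NormedAddCommGroup F]
    [NormedSpace ℝ F] (φ : Euc N → F) (i : Fin N) : tsupport (pderiv i φ) ⊆ tsupport φ :=
  closure_minimal (fun x hx ↦ by
    by_contra h
    exact hx (pderiv_eq_zero_of_notMem_tsupport h i)) (isClosed_tsupport φ)

/-- `∂ᵢφ` as a test function. -/
noncomputable def pderivTest {N : ℕ} {Ω : Opens (Euc N)} (i : Fin N) (φ : 𝓓(Ω, ℝ)) : 𝓓(Ω, ℝ) where
  toFun := pderiv i φ
  contDiff' := contDiff_pderiv φ.contDiff i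
  hasCompactSupport' := φ.hasCompactSupport.of_isClosed_subset (isClosed_tsupport _)
    (tsupport_pderiv_subset _ i)
  tsupport_subset' := (tsupport_pderiv_subset _ i).trans φ.tsupport_subset

lemma laplacian_eq_sum_pderiv {N : ℕ} {φ : Euc N → ℝ} (hφ : ContDiff ℝ (⊤ : ℕ∞) φ) (x : Euc N) :
    Laplacian.laplacian φ x = ∑ i, pderiv i (pderiv i φ) x := by
  rw [InnerProductSpace.laplacian_eq_iteratedFDeriv_orthonormalBasis φ
    (EuclideanSpace.basisFun (Fin N) ℝ)]
  refine Finset.sum_congr rfl fun i _ ↦ ?_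
  have hd : DifferentiableAt ℝ (fderiv ℝ φ) x :=
    (hφ.fderiv_right (m := 1) (by norm_cast)).differentiable one_ne_zero x
  rw [iteratedFDeriv_two_apply]
  have : pderiv i φ = fun y ↦ fderiv ℝ φ y (EuclideanSpace.single i 1) := rfl
  rw [pderiv, this, fderiv_clm_apply hd (by fun_prop)]
  simp

section Weak

variable {N d : ℕ} {Ω : Opens (Euc N)} {u h : Euc N → Euc d} {w : Fin N → Euc N → Euc d}

lemma integrableOn_test_smul {F : Type*} [NormedAddCommGroup F] [NormedSpace ℝ F] (φ : 𝓓(Ω, ℝ))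
    {h : Euc N → F} (hh : LocallyIntegrableOn h (Ω : Set (Euc N))) :
    IntegrableOn (fun x ↦ φ x • h x) (Ω : Set (Euc N)) := by
  obtain ⟨C, hC⟩ := φ.hasCompactSupport.exists_bound_of_continuous φ.continuous
  refine integrableOn_of_norm_le_of_isCompact φ.hasCompactSupport φ.tsupport_subset hh
    (φ.continuous.aestronglyMeasurable.smul
      (hh.aestronglyMeasurable)) C (fun x ↦ ?_) fun x hx ↦ ?_
  · rw [norm_smul]
    gcongr
    exact hC x
  · rw [image_eq_zero_of_notMem_tsupport hx, zero_smul]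

/-- The equation `Δu = h` in first-order form. -/
lemma sum_integral_pderiv_smul_eq (hw : ∀ i, HasWeakPartial Ω i u (w i))
    (hΔ : ∀ φ : 𝓓(Ω, ℝ), ∫ x in (Ω : Set (Euc N)), (Laplacian.laplacian (φ : Euc N → ℝ) x) • u x =
      ∫ x in (Ω : Set (Euc N)), φ x • h x) (φ : 𝓓(Ω, ℝ)) :
    ∑ i, ∫ x in (Ω : Set (Euc N)), pderiv i φ x • w i x =
      -∫ x in (Ω : Set (Euc N)), φ x • h x := by
  rw [← hΔ φ]
  simp_rw [laplacian_eq_sum_pderiv φ.contDiff, Finset.sum_smul]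
  have hsum : ∫ x in (Ω : Set (Euc N)), ∑ i, pderiv i (pderiv i φ) x • u x =
      ∑ i, ∫ x in (Ω : Set (Euc N)), pderiv i (pderiv i φ) x • u x :=
    integral_finsetSum _ fun i _ ↦ integrableOn_test_smul (pderivTest i (pderivTest i φ)) (hw i).1
  rw [hsum, ← Finset.sum_neg_distrib]
  refine Finset.sum_congr rfl fun i _ ↦ ?_
  have := (hw i).2.2 (pderivTest i φ)
  rw [eq_neg_iff_add_eq_zero, add_comm, ← eq_neg_iff_add_eq_zero]
  exact this

/-- The first-order form tested with a field of linear functionals. -/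
lemma sum_integral_pderiv_clm_eq (hw : ∀ i, HasWeakPartial Ω i u (w i))
    (hh : LocallyIntegrableOn h (Ω : Set (Euc N)))
    (hΔ : ∀ φ : 𝓓(Ω, ℝ), ∫ x in (Ω : Set (Euc N)), (Laplacian.laplacian (φ : Euc N → ℝ) x) • u x =
      ∫ x in (Ω : Set (Euc N)), φ x • h x) (A : 𝓓(Ω, Euc d →L[ℝ] ℝ)) :
    ∑ i, ∫ x in (Ω : Set (Euc N)), pderiv i A x (w i x) = -∫ x in (Ω : Set (Euc N)), A x (h x) := by
  let φ : Fin d → 𝓓(Ω, ℝ) := fun a ↦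
    { toFun := fun x ↦ A x (EuclideanSpace.single a 1)
      contDiff' := A.contDiff.clm_apply contDiff_const
      hasCompactSupport' := A.hasCompactSupport.mono fun x hx h ↦ hx (by simp [h])
      tsupport_subset' := (closure_mono (Function.support_subset_iff'.mpr fun x hx ↦ by
        simp [Function.notMem_support.mp hx])).trans A.tsupport_subset }
  have hφ : ∀ a x, φ a x = A x (EuclideanSpace.single a 1) := fun _ _ ↦ rfl
  let ev : Fin d → Euc d →L[ℝ] ℝ := fun a ↦ EuclideanSpace.proj a
  have hexp : ∀ (B : Euc d →L[ℝ] ℝ) (v : Euc d),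
      B v = ∑ a, B (EuclideanSpace.single a 1) * v a := fun B v ↦ by
    conv_lhs => rw [← (EuclideanSpace.basisFun (Fin d) ℝ).sum_repr v]
    simp [mul_comm]
  have hpd : ∀ i a x, pderiv i (φ a) x = pderiv i A x (EuclideanSpace.single a 1) := fun i a x ↦ by
    have hd : DifferentiableAt ℝ A x := A.contDiff.differentiable (by simp) x
    have : (φ a : Euc N → ℝ) = fun x ↦ A x (EuclideanSpace.single a 1) := rfl
    rw [pderiv, this, fderiv_clm_apply hd (by fun_prop)]
    simp [pderiv]
  have hcomp : ∀ (ψ : 𝓓(Ω, ℝ)) {k : Euc N → Euc d}, LocallyIntegrableOn k (Ω : Set (Euc N)) →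
      ∀ a, IntegrableOn (fun x ↦ ψ x * k x a) (Ω : Set (Euc N)) ∧
        (∫ x in (Ω : Set (Euc N)), ψ x • k x) a = ∫ x in (Ω : Set (Euc N)), ψ x * k x a := by
    intro ψ k hk a
    have hi := integrableOn_test_smul ψ hk
    refine ⟨(ev a).integrable_comp hi, ((ev a).integral_comp_comm hi).symm⟩
  have h1 : ∀ a, ∑ i, ∫ x in (Ω : Set (Euc N)), pderiv i (φ a) x * w i x a =
      -∫ x in (Ω : Set (Euc N)), φ a x * h x a := fun a ↦ by
    have := congrArg (ev a)
      (sum_integral_pderiv_smul_eq hw hΔ (φ a))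
    rw [map_sum, map_neg] at this
    refine Eq.trans ?_ (this.trans (congrArg Neg.neg (hcomp (φ a) hh a).2))
    exact Finset.sum_congr rfl fun i _ ↦ ((hcomp (pderivTest i (φ a)) (hw i).2.1 a).2).symm
  have h2 : ∀ i, ∫ x in (Ω : Set (Euc N)), pderiv i A x (w i x) =
      ∑ a, ∫ x in (Ω : Set (Euc N)), pderiv i (φ a) x * w i x a := fun i ↦ by
    refine Eq.trans ?_ (integral_finsetSum _ fun a _ ↦
      (hcomp (pderivTest i (φ a)) (hw i).2.1 a).1)
    congr 1
    ext x
    rw [hexp (pderiv i A x)]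
    exact Finset.sum_congr rfl fun a _ ↦ by rw [← hpd]
  have h3 : ∫ x in (Ω : Set (Euc N)), A x (h x) =
      ∑ a, ∫ x in (Ω : Set (Euc N)), φ a x * h x a := by
    rw [← integral_finsetSum _ fun a _ ↦ (hcomp (φ a) hh a).1]
    congr 1
    ext x
    rw [hexp (A x)]
    simp_rw [hφ]
  simp_rw [h2]
  rw [h3, Finset.sum_comm, ← Finset.sum_neg_distrib]
  exact Finset.sum_congr rfl fun a _ ↦ h1 a

/-- Kato's inequality `Δ p(u) ≥ p'(u) Δu` for a smooth convex function `p` of a solution of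
`Δu = h` with `h` only locally integrable, in weak form. The test field `φ p'(ψ k)` is smooth with
compact support; convexity of `p` gives the sign of the second-order term up to an error which
vanishes as `k → ∞`. -/
lemma sum_integral_pderiv_mul_le (hΩ : Bornology.IsBounded (Ω : Set (Euc N)))
    {ψ : ℕ → Euc N → Euc d} (ha : H1Approx Ω u w ψ)
    (hae : ∀ᵐ x ∂(volume.restrict (Ω : Set (Euc N))), Tendsto (fun k ↦ ψ k x) atTop (𝓝 (u x)))
    (hw : ∀ i, HasWeakPartial Ω i u (w i))
    (hh : LocallyIntegrableOn h (Ω : Set (Euc N)))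
    (hΔ : ∀ φ : 𝓓(Ω, ℝ), ∫ x in (Ω : Set (Euc N)), (Laplacian.laplacian (φ : Euc N → ℝ) x) • u x =
      ∫ x in (Ω : Set (Euc N)), φ x • h x)
    {p : Euc d → ℝ} (hp : ContDiff ℝ (⊤ : ℕ∞) p) {L₁ L₂ : ℝ} (hL₁ : ∀ y, ‖fderiv ℝ p y‖ ≤ L₁)
    (hL₂ : ∀ y, ‖fderiv ℝ (fderiv ℝ p) y‖ ≤ L₂) (hconv : ∀ y v, 0 ≤ fderiv ℝ (fderiv ℝ p) y v v)
    (φ : 𝓓(Ω, ℝ)) (hφ : ∀ x, 0 ≤ φ x) :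
    ∑ i, ∫ x in (Ω : Set (Euc N)), pderiv i φ x * fderiv ℝ p (u x) (w i x) ≤
      -∫ x in (Ω : Set (Euc N)), φ x * fderiv ℝ p (u x) (h x) := by
  have hp1 : ContDiff ℝ (⊤ : ℕ∞) (fderiv ℝ p) := hp.fderiv_right (by simp)
  have hp2 : ContDiff ℝ (⊤ : ℕ∞) (fderiv ℝ (fderiv ℝ p)) := hp1.fderiv_right (by simp)
  have hLw : ∀ y v, ‖fderiv ℝ p y v‖ ≤ L₁ * ‖v‖ := fun y v ↦
    ((fderiv ℝ p y).le_opNorm v).trans (by gcongr; exact hL₁ y)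
  have hLw2 : ∀ y v v', ‖fderiv ℝ (fderiv ℝ p) y v v'‖ ≤ L₂ * (‖v‖ * ‖v'‖) := fun y v v' ↦ by
    refine ((fderiv ℝ (fderiv ℝ p) y).le_opNorm₂ v v').trans ?_
    rw [mul_assoc]
    gcongr
    exact hL₂ y
  have hL₂0 : 0 ≤ L₂ := le_trans (by positivity) (hL₂ 0)
  let A : ℕ → 𝓓(Ω, Euc d →L[ℝ] ℝ) := fun k ↦
    { toFun := fun x ↦ φ x • fderiv ℝ p (ψ k x)
      contDiff' := φ.contDiff.smul (hp1.comp (ha.contDiff k))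
      hasCompactSupport' := φ.hasCompactSupport.smul_right
      tsupport_subset' := (tsupport_smul_subset_left _ _).trans φ.tsupport_subset }
  have hAx : ∀ k x, A k x = φ x • fderiv ℝ p (ψ k x) := fun _ _ ↦ rfl
  have hAd : ∀ k i x v, pderiv i (A k) x v = pderiv i φ x * fderiv ℝ p (ψ k x) v +
      φ x * fderiv ℝ (fderiv ℝ p) (ψ k x) (pderiv i (ψ k) x) v := fun k i x v ↦ by
    have h1 : DifferentiableAt ℝ φ x := φ.contDiff.differentiable (by simp) x
    have h2 : DifferentiableAt ℝ (ψ k) x := (ha.contDiff k).differentiable (by simp) x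
    have h3 : DifferentiableAt ℝ (fderiv ℝ p) (ψ k x) := hp1.differentiable (by simp) _
    have h4 : (A k : Euc N → Euc d →L[ℝ] ℝ) = fun x ↦ φ x • (fderiv ℝ p ∘ ψ k) x := rfl
    rw [pderiv, h4, fderiv_fun_smul h1 (h3.comp x h2), fderiv_comp x h3 h2]
    simp [pderiv, add_comm]
  obtain ⟨Cφ, hCφ⟩ := φ.hasCompactSupport.exists_bound_of_continuous φ.continuous
  have hCφ0 : 0 ≤ Cφ := (norm_nonneg _).trans (hCφ 0)
  -- the second-order terms, up to a nonnegative contribution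
  set e : ℕ → Fin N → ℝ := fun k i ↦ ∫ x in (Ω : Set (Euc N)),
    φ x * fderiv ℝ (fderiv ℝ p) (ψ k x) (pderiv i (ψ k) x - w i x) (w i x) with he
  have hψm : ∀ k, AEStronglyMeasurable (ψ k) (volume.restrict (Ω : Set (Euc N))) := fun k ↦
    (ha.contDiff k).continuous.aestronglyMeasurable
  have hD2int : ∀ k i {z : Euc N → Euc d}, MemLp z 2 (volume.restrict (Ω : Set (Euc N))) →
      IntegrableOn (fun x ↦ φ x * fderiv ℝ (fderiv ℝ p) (ψ k x) (z x) (w i x))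
        (Ω : Set (Euc N)) := by
    intro k i z hz
    have hi : Integrable (fun x ↦ Cφ * (L₂ * (‖z x‖ * ‖w i x‖)))
        (volume.restrict (Ω : Set (Euc N))) :=
      ((hz.norm.integrable_mul (ha.memLp_deriv i).norm).const_mul L₂).const_mul Cφ
    refine hi.mono' ?_ (ae_of_all _ fun x ↦ ?_)
    · exact φ.continuous.aestronglyMeasurable.mul (aestronglyMeasurable_clm_apply
        (aestronglyMeasurable_clm_apply (hp2.continuous.comp_aestronglyMeasurable (hψm k)) hz.1)
        (ha.memLp_deriv i).1)
    · rw [norm_mul]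
      gcongr
      exacts [hCφ x, hLw2 _ _ _]
  have hD1int : ∀ k i, IntegrableOn (fun x ↦ pderiv i φ x * fderiv ℝ p (ψ k x) (w i x))
      (Ω : Set (Euc N)) := by
    intro k i
    obtain ⟨C, hC⟩ := (pderivTest i φ).hasCompactSupport.exists_bound_of_continuous
      (pderivTest i φ).continuous
    refine integrableOn_of_norm_le_of_isCompact (pderivTest i φ).hasCompactSupport
      (pderivTest i φ).tsupport_subset (hw i).2.1 ?_ (C * L₁) (fun x ↦ ?_) fun x hx ↦ ?_
    · exact (pderivTest i φ).continuous.aestronglyMeasurable.mul (aestronglyMeasurable_clm_apply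
        (hp1.continuous.comp_aestronglyMeasurable (hψm k)) (ha.memLp_deriv i).1)
    · rw [norm_mul, mul_assoc]
      exact mul_le_mul (hC x) (hLw _ _) (norm_nonneg _) ((norm_nonneg _).trans (hC x))
    · have : pderiv i φ x = 0 := image_eq_zero_of_notMem_tsupport hx
      rw [this, zero_mul]
  have hineq : ∀ k, (∑ i, ∫ x in (Ω : Set (Euc N)), pderiv i φ x * fderiv ℝ p (ψ k x) (w i x)) +
      ∑ i, e k i ≤ -∫ x in (Ω : Set (Euc N)), φ x * fderiv ℝ p (ψ k x) (h x) := by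
    intro k
    have h1 := sum_integral_pderiv_clm_eq hw hh hΔ (A k)
    have h2 : ∫ x in (Ω : Set (Euc N)), A k x (h x) =
        ∫ x in (Ω : Set (Euc N)), φ x * fderiv ℝ p (ψ k x) (h x) := by
      simp [hAx]
    rw [← h2, ← h1, ← Finset.sum_add_distrib]
    refine Finset.sum_le_sum fun i _ ↦ ?_
    simp_rw [hAd]
    rw [integral_add (hD1int k i) (hD2int k i (ha.memLp_pderiv_seq hΩ i k))]
    gcongr
    refine integral_mono (hD2int k i ((ha.memLp_pderiv_seq hΩ i k).sub (ha.memLp_deriv i)))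
      (hD2int k i (ha.memLp_pderiv_seq hΩ i k)) fun x ↦ ?_
    simp only [map_sub, _root_.sub_apply]
    have := mul_nonneg (hφ x) (hconv (ψ k x) (w i x))
    linarith
  have he0 : ∀ i, Tendsto (fun k ↦ e k i) atTop (𝓝 0) := by
    intro i
    have h1 := tendsto_integral_mul_of_tendsto_eLpNorm (μ := volume.restrict (Ω : Set (Euc N)))
      (f := fun k x ↦ ‖pderiv i (ψ k) x - w i x‖) (f₀ := fun _ ↦ 0)
      (g := fun _ x ↦ ‖w i x‖) (g₀ := fun x ↦ ‖w i x‖)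
      (fun k ↦ ((ha.memLp_pderiv_seq hΩ i k).sub (ha.memLp_deriv i)).norm)
      MemLp.zero (fun _ ↦ (ha.memLp_deriv i).norm) (ha.memLp_deriv i).norm
      (tendsto_eLpNorm_of_le 1 (fun k ↦ ae_of_all _ fun x ↦ by simp) (ha.tendsto_deriv i))
      (tendsto_eLpNorm_of_le 1 (fun k ↦ ae_of_all _ fun x ↦ by simp) (ha.tendsto_deriv i))
    have h2 := (h1.const_mul L₂).const_mul Cφ
    simp only [zero_mul, integral_zero, mul_zero] at h2
    refine squeeze_zero_norm (fun k ↦ ?_) h2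
    rw [← integral_const_mul, ← integral_const_mul]
    refine norm_integral_le_of_norm_le ?_ (ae_of_all _ fun x ↦ ?_)
    · exact ((((ha.memLp_pderiv_seq hΩ i k).sub (ha.memLp_deriv i)).norm.integrable_mul
        (ha.memLp_deriv i).norm).const_mul L₂).const_mul Cφ
    · rw [norm_mul]
      gcongr
      exacts [hCφ x, hLw2 _ _ _]
  have hpt : ∀ᵐ x ∂(volume.restrict (Ω : Set (Euc N))), ∀ v,
      Tendsto (fun k ↦ fderiv ℝ p (ψ k x) v) atTop (𝓝 (fderiv ℝ p (u x) v)) := by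
    filter_upwards [hae] with x hx v
    exact (((ContinuousLinearMap.apply ℝ ℝ v).continuous.comp hp1.continuous).tendsto _).comp hx
  have hlim1 : ∀ i, Tendsto (fun k ↦ ∫ x in (Ω : Set (Euc N)),
      pderiv i φ x * fderiv ℝ p (ψ k x) (w i x)) atTop
      (𝓝 (∫ x in (Ω : Set (Euc N)), pderiv i φ x * fderiv ℝ p (u x) (w i x))) := by
    intro i
    refine tendsto_integral_of_dominated_convergence (fun x ↦ L₁ * ‖pderiv i φ x • w i x‖)
      (fun k ↦ (hD1int k i).1)
      ((integrableOn_test_smul (pderivTest i φ) (hw i).2.1).norm.const_mul L₁)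
      (fun k ↦ ae_of_all _ fun x ↦ ?_) ?_
    · rw [norm_mul, norm_smul, mul_left_comm]
      gcongr
      exact hLw _ _
    · filter_upwards [hpt] with x hx
      exact (hx _).const_mul _
  have hlim2 : Tendsto (fun k ↦ ∫ x in (Ω : Set (Euc N)), φ x * fderiv ℝ p (ψ k x) (h x)) atTop
      (𝓝 (∫ x in (Ω : Set (Euc N)), φ x * fderiv ℝ p (u x) (h x))) := by
    refine tendsto_integral_of_dominated_convergence (fun x ↦ L₁ * ‖φ x • h x‖)
      (fun k ↦ ?_) ((integrableOn_test_smul φ hh).norm.const_mul L₁)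
      (fun k ↦ ae_of_all _ fun x ↦ ?_) ?_
    · exact φ.continuous.aestronglyMeasurable.mul (aestronglyMeasurable_clm_apply
        (hp1.continuous.comp_aestronglyMeasurable (hψm k)) hh.aestronglyMeasurable)
    · rw [norm_mul, norm_smul, mul_left_comm]
      gcongr
      exact hLw _ _
    · filter_upwards [hpt] with x hx
      exact (hx _).const_mul _
  have hlim3 := (tendsto_finsetSum Finset.univ fun i _ ↦ hlim1 i).add
    (tendsto_finsetSum Finset.univ fun i _ ↦ he0 i)
  simp only [Finset.sum_const_zero, add_zero] at hlim3
  exact le_of_tendsto_of_tendsto' hlim3 hlim2.neg hineq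

end Weak

/-! ### Mollification along shifted kernels -/

section Mollify

variable {N : ℕ} {A B : Euc N → ℝ}

lemma memLp_comp_add (hB : MemLp B 2 volume) (y : Euc N) : MemLp (fun x ↦ B (x + y)) 2 volume :=
  hB.comp_measurePreserving (measurePreserving_add_right volume y)

/-- Continuity of translations in `L²`, paired with a fixed function. -/
lemma continuous_integral_mul_translate (hA : MemLp A 2 volume) (hB : MemLp B 2 volume) :
    Continuous fun y ↦ ∫ x, A x * B (x + y) := by
  let g : Euc N → C(Euc N, Euc N) := (ContinuousMap.mk (fun q : Euc N × Euc N ↦ q.2 + q.1)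
    (by fun_prop)).curry
  have hg : Continuous g := ContinuousMap.continuous _
  have hgm : ∀ y, MeasurePreserving (g y) volume volume := fun y ↦
    measurePreserving_add_right volume y
  have h1 : Continuous fun y ↦ Lp.compMeasurePreserving (g y) (hgm y) (hB.toLp B) :=
    (continuous_const (y := hB.toLp B)).compMeasurePreservingLp hg hgm ENNReal.ofNat_ne_top
  refine ((continuous_const (y := hA.toLp A)).inner h1 (𝕜 := ℝ)).congr fun y ↦ ?_
  rw [L2.inner_def]
  refine integral_congr_ae ?_
  rw [Lp.toLp_compMeasurePreserving hB (hgm y)]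
  filter_upwards [hA.coeFn_toLp, (hB.comp_measurePreserving (hgm y)).coeFn_toLp] with x h1 h2
  rw [h1, h2]
  simp [g, mul_comm]

lemma integral_mul_convolution (hA : MemLp A 2 volume) (hB : MemLp B 2 volume) {k : Euc N → ℝ}
    (hk : Continuous k) (hkc : HasCompactSupport k) :
    ∫ x, A x * ∫ z, B z * k (x - z) = ∫ s, k s * ∫ x, A x * B (x + -s) := by
  have h1 : ∀ x, ∫ z, B z * k (x - z) = ∫ s, k s * B (x - s) := fun x ↦ by
    rw [← integral_sub_left_eq_self _ _ x]
    simp [mul_comm]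
  simp_rw [h1, ← integral_const_mul]
  rw [integral_integral_swap]
  · congr 1; ext s; congr 1; ext x
    rw [← sub_eq_add_neg]; ring
  · have hm : AEStronglyMeasurable (fun q : Euc N × Euc N ↦ A q.1 * (k q.2 * B (q.1 - q.2)))
        (volume.prod volume) :=
      hA.1.comp_fst.mul
        (hk.aestronglyMeasurable.convolution_integrand (ContinuousLinearMap.mul ℝ ℝ) hB.1)
    refine (integrable_prod_iff' hm).mpr ⟨ae_of_all _ fun s ↦ ?_, ?_⟩
    · have := (hA.integrable_mul (memLp_comp_add hB (-s))).const_mul (k s)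
      refine this.congr (ae_of_all _ fun x ↦ ?_)
      simp only [Pi.mul_apply, ← sub_eq_add_neg]
      ring
    · have hc : Continuous fun s ↦ ‖k s‖ * ∫ x, ‖A x‖ * ‖B (x + -s)‖ :=
        hk.norm.mul ((continuous_integral_mul_translate hA.norm hB.norm).comp continuous_neg)
      refine (hc.integrable_of_hasCompactSupport hkc.norm.mul_right).congr
        (ae_of_all _ fun s ↦ ?_)
      simp only [norm_mul]
      rw [← integral_const_mul]
      congr 1; ext x
      rw [← sub_eq_add_neg]; ring

/-- Convolutions with kernels that concentrate at the origin, without being centred there, converge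
weakly in `L²`. -/
lemma tendsto_integral_mul_convolution (hA : MemLp A 2 volume) (hB : MemLp B 2 volume)
    {k : ℕ → Euc N → ℝ} (hk : ∀ n, Continuous (k n)) (hkc : ∀ n, HasCompactSupport (k n))
    (hk0 : ∀ n x, 0 ≤ k n x) (hk1 : ∀ n, ∫ x, k n x = 1) {δ : ℕ → ℝ}
    (hδ : Tendsto δ atTop (𝓝 0)) (hkδ : ∀ n x, k n x ≠ 0 → ‖x‖ ≤ δ n) :
    Tendsto (fun n ↦ ∫ x, A x * ∫ z, B z * k n (x - z)) atTop (𝓝 (∫ x, A x * B x)) := by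
  simp_rw [fun n ↦ integral_mul_convolution hA hB (hk n) (hkc n)]
  have hc := (continuous_integral_mul_translate hA hB).comp continuous_neg
  rw [Metric.tendsto_atTop]
  intro ε hε
  obtain ⟨η, hη, hball⟩ := Metric.continuous_iff.mp hc 0 (ε / 2) (by positivity)
  obtain ⟨n₀, hn₀⟩ := eventually_atTop.mp (hδ.eventually (gt_mem_nhds hη))
  refine ⟨n₀, fun n hn ↦ ?_⟩
  have hki := (hk n).integrable_of_hasCompactSupport (μ := volume) (hkc n)
  have h2 : (∫ s, k n s * ∫ x, A x * B (x + -s)) - ∫ x, A x * B x =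
      ∫ s, k n s * ((∫ x, A x * B (x + -s)) - ∫ x, A x * B x) := by
    simp_rw [mul_sub]
    rw [integral_sub, integral_mul_const, hk1, one_mul]
    · exact ((hk n).mul hc).integrable_of_hasCompactSupport (hkc n).mul_right
    · exact hki.mul_const _
  rw [dist_eq_norm, h2]
  refine lt_of_le_of_lt (norm_integral_le_of_norm_le (hki.mul_const (ε / 2))
    (ae_of_all _ fun s ↦ ?_)) ?_
  · rw [norm_mul, Real.norm_of_nonneg (hk0 n s)]
    by_cases hs : k n s = 0
    · simp [hs]
    · gcongr
      · exact hk0 n s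
      have := hball s (by simpa using (hkδ n s hs).trans_lt (hn₀ n hn))
      rw [dist_eq_norm] at this
      simpa using this.le
  · rw [integral_mul_const, hk1]; linarith

lemma pderiv_convolution (hB : LocallyIntegrable B volume) {k : Euc N → ℝ}
    (hk : ContDiff ℝ (⊤ : ℕ∞) k) (hkc : HasCompactSupport k) :
    ContDiff ℝ (⊤ : ℕ∞) (fun x ↦ ∫ z, B z * k (x - z)) ∧
    ∀ i x, pderiv i (fun x ↦ ∫ z, B z * k (x - z)) x = ∫ z, B z * pderiv i k (x - z) := by
  have he : (fun x ↦ ∫ z, B z * k (x - z)) = (B ⋆[ContinuousLinearMap.mul ℝ ℝ, volume] k) := rfl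
  refine ⟨he ▸ hkc.contDiff_convolution_right _ hB hk, fun i x ↦ ?_⟩
  have hk1 : ContDiff ℝ 1 k := hk.of_le (by simp)
  have h1 := hkc.hasFDerivAt_convolution_right (ContinuousLinearMap.mul ℝ ℝ) hB hk1 x
  rw [he, pderiv, h1.fderiv, convolution_precompR_apply _ hB (hkc.fderiv ℝ)
    (hk1.continuous_fderiv one_ne_zero)]
  rfl

end Mollify

/-! ### Testing the inequality with the function itself -/

namespace H1Approx

variable {N : ℕ} {Ω : Opens (Euc N)} {P : Euc N → ℝ} {G : Fin N → Euc N → ℝ} {Ψ : ℕ → Euc N → ℝ}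

/-- The differential inequality `-Δ P ≤ κ P`, known for test functions with compact support in `Ω`,
tested with `χ P` for a cut-off `χ` supported near `x₀`. The admissible test functions are the
convolutions of `χ P` with kernels that move its support inside `Ω` and concentrate at the origin;
`integral_mul_pderiv` identifies their derivatives. -/
lemma sum_integral_mul_localized_le (hN : 1 ≤ N) (hΩ : IsSmoothBoundedDomain Ω)
    (h : H1Approx Ω P G Ψ)
    (htr : Tendsto (fun k ↦ eLpNorm (Ψ k) 2 (surfaceMeasure Ω)) atTop (𝓝 0))
    (hP : ∀ x, 0 ≤ P x) {κ : ℝ}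
    (hsub : ∀ φ : 𝓓(Ω, ℝ), (∀ x, 0 ≤ φ x) →
      ∑ i, ∫ x in (Ω : Set (Euc N)), pderiv i φ x * G i x ≤
        κ * ∫ x in (Ω : Set (Euc N)), φ x * P x)
    {x₀ ν : Euc N} {ρ : ℝ} (hρ : 0 < ρ)
    (hshift : ∀ t ∈ Ioo 0 ρ, ∀ z ∈ closure (Ω : Set (Euc N)) ∩ closedBall x₀ ρ, z - t • ν ∈ Ω)
    {χ : Euc N → ℝ} (hχ : ContDiff ℝ (⊤ : ℕ∞) χ) (hχ0 : ∀ x, 0 ≤ χ x)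
    (hχs : tsupport χ ⊆ ball x₀ ρ) :
    ∑ i, ∫ x in (Ω : Set (Euc N)), G i x * (pderiv i χ x * P x + χ x * G i x) ≤
      κ * ∫ x in (Ω : Set (Euc N)), P x * (χ x * P x) := by
  have hb := hΩ.2.1
  have hΩm : MeasurableSet (Ω : Set (Euc N)) := Ω.isOpen.measurableSet
  have hχc : HasCompactSupport χ :=
    (isCompact_closedBall x₀ ρ).of_isClosed_subset (isClosed_tsupport _)
      (hχs.trans ball_subset_closedBall)
  have hχ1 : ContDiff ℝ 1 χ := hχ.of_le (by simp)
  set K := closure (Ω : Set (Euc N)) ∩ closedBall x₀ ρ with hK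
  have hKc : IsCompact K := hb.isCompact_closure.inter_right isClosed_closedBall
  -- a kernel concentrated near `-t • ν`
  have hker : ∀ n : ℕ, ∃ k : Euc N → ℝ, ContDiff ℝ (⊤ : ℕ∞) k ∧ HasCompactSupport k ∧
      (∀ x, 0 ≤ k x) ∧ (∫ x, k x = 1) ∧ (∀ x, k x ≠ 0 → ‖x‖ ≤ (ρ * ‖ν‖ + 1) * (1 / ((n : ℝ) + 2))) ∧
      ∃ K' ⊆ (Ω : Set (Euc N)), IsCompact K' ∧ ∀ z ∈ K, ∀ x, k (x - z) ≠ 0 → x ∈ K' := by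
    intro n
    set t : ℝ := ρ * (1 / ((n : ℝ) + 2)) with ht
    have hn : (0 : ℝ) < 1 / ((n : ℝ) + 2) := by positivity
    have hn1 : 1 / ((n : ℝ) + 2) < 1 := by
      rw [div_lt_one (by positivity)]; linarith [n.cast_nonneg (α := ℝ)]
    have htρ : t ∈ Ioo 0 ρ := ⟨by positivity, by rw [ht]; exact mul_lt_of_lt_one_right hρ hn1⟩
    have hKt : IsCompact ((fun z ↦ z - t • ν) '' K) := hKc.image (by fun_prop)
    obtain ⟨ε, hε, hεΩ⟩ := hKt.exists_cthickening_subset_open Ω.isOpen (by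
      rintro _ ⟨z, hz, rfl⟩
      exact hshift t htρ z hz)
    set η := min ε (1 / ((n : ℝ) + 2)) with hη
    have hη0 : 0 < η := lt_min hε hn
    let β : ContDiffBump (-(t • ν)) := ⟨η / 2, η, by positivity, by linarith⟩
    have hβ : ∀ x, β.normed volume x ≠ 0 → dist x (-(t • ν)) < η := fun x hx ↦ by
      have : x ∈ Function.support (β.normed volume) := hx
      rwa [β.support_normed_eq] at this
    refine ⟨β.normed volume, β.contDiff_normed, β.hasCompactSupport_normed, β.nonneg_normed,
      β.integral_normed, fun x hx ↦ ?_, _, hεΩ, hKt.cthickening, fun z hz x hx ↦ ?_⟩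
    · have h1 := hβ x hx
      rw [dist_eq_norm, sub_neg_eq_add] at h1
      have h2 : ‖x‖ ≤ ‖x + t • ν‖ + ‖t • ν‖ := by
        simpa using norm_sub_le (x + t • ν) (t • ν)
      rw [norm_smul, Real.norm_of_nonneg htρ.1.le] at h2
      have h3 : η ≤ 1 / ((n : ℝ) + 2) := min_le_right _ _
      have h4 : t * ‖ν‖ = ρ * ‖ν‖ * (1 / ((n : ℝ) + 2)) := by rw [ht]; ring
      rw [add_mul, one_mul]
      linarith
    · have h1 := hβ _ hx
      refine mem_cthickening_of_dist_le x (z - t • ν) ε _ ⟨z, hz, rfl⟩ ?_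
      rw [dist_eq_norm] at h1 ⊢
      have : x - (z - t • ν) = x - z - -(t • ν) := by abel
      rw [this]
      exact h1.le.trans (min_le_left _ _)
  choose k hks hkc hk0 hk1 hkδ hkK using hker
  have hδ : Tendsto (fun n : ℕ ↦ (ρ * ‖ν‖ + 1) * (1 / ((n : ℝ) + 2))) atTop (𝓝 0) := by
    have h1 : Tendsto (fun n : ℕ ↦ 1 / ((n : ℝ) + 2)) atTop (𝓝 0) := by
      have := (tendsto_one_div_add_atTop_nhds_zero_nat (𝕜 := ℝ)).comp (tendsto_add_atTop_nat 1)
      refine this.congr fun n ↦ ?_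
      simp only [Function.comp_apply]
      push_cast
      ring
    simpa using h1.const_mul (ρ * ‖ν‖ + 1)
  -- extensions by zero
  have hext : ∀ {a : Euc N → ℝ}, MemLp a 2 (volume.restrict (Ω : Set (Euc N))) →
      MemLp ((Ω : Set (Euc N)).indicator a) 2 volume := fun ha ↦ (memLp_indicator_iff_restrict hΩm).mpr ha
  have hextint : ∀ a b : Euc N → ℝ, ∫ x, (Ω : Set (Euc N)).indicator a x * b x =
      ∫ x in (Ω : Set (Euc N)), a x * b x := fun a b ↦ by
    rw [← integral_indicator hΩm]
    congr 1; ext x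
    by_cases hx : x ∈ (Ω : Set (Euc N)) <;> simp [hx]
  have hbm : ∀ {c a : Euc N → ℝ}, Continuous c → HasCompactSupport c →
      MemLp a 2 (volume.restrict (Ω : Set (Euc N))) →
      MemLp (fun x ↦ c x * a x) 2 (volume.restrict (Ω : Set (Euc N))) := by
    intro c a hc hcc ha
    obtain ⟨C, hC⟩ := hcc.exists_bound_of_continuous hc
    refine MemLp.of_le_mul (c := C) ha (hc.aestronglyMeasurable.mul ha.1) (ae_of_all _ fun x ↦ ?_)
    rw [norm_mul]
    gcongr
    exact hC x
  have hdχc : ∀ i, HasCompactSupport (pderiv i χ) := fun i ↦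
    hχc.of_isClosed_subset (isClosed_tsupport _) (tsupport_pderiv_subset _ i)
  have hB : MemLp (fun x ↦ χ x * P x) 2 (volume.restrict (Ω : Set (Euc N))) :=
    hbm hχ.continuous hχc h.memLp
  have hH : ∀ i, MemLp (fun x ↦ pderiv i χ x * P x + χ x * G i x) 2
      (volume.restrict (Ω : Set (Euc N))) := fun i ↦
    (hbm (continuous_pderiv hχ1 i) (hdχc i) h.memLp).add
      (hbm hχ.continuous hχc (h.memLp_deriv i))
  set B := (Ω : Set (Euc N)).indicator fun x ↦ χ x * P x with hBdef
  set H : Fin N → Euc N → ℝ := fun i ↦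
    (Ω : Set (Euc N)).indicator fun x ↦ pderiv i χ x * P x + χ x * G i x with hHdef
  have hBl : LocallyIntegrable B volume := (hext hB).locallyIntegrable (by norm_num)
  set φ : ℕ → Euc N → ℝ := fun n x ↦ ∫ z, B z * k n (x - z) with hφ
  have hφd : ∀ n i x, pderiv i (φ n) x = ∫ z, H i z * k n (x - z) := by
    intro n i x
    rw [(pderiv_convolution hBl (hks n) (hkc n)).2 i x]
    have hk1 : ContDiff ℝ 1 (k n) := (hks n).of_le (by simp)
    have hk1' : ContDiff ℝ 1 (fun z ↦ k n (x - z)) := hk1.comp (contDiff_const.sub contDiff_id)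
    have h1 := h.integral_mul_pderiv hN hΩ htr (hχ1.mul hk1') i
    have h2 : ∀ z, pderiv i (fun z ↦ k n (x - z)) z = -pderiv i (k n) (x - z) := fun z ↦ by
      have : HasFDerivAt (fun z ↦ k n (x - z)) _ z :=
        (hk1.differentiable one_ne_zero (x - z)).hasFDerivAt.comp z ((hasFDerivAt_id z).const_sub x)
      rw [pderiv, this.fderiv]
      simp [pderiv]
    have h3 : ∀ z, pderiv i (fun z ↦ χ z * k n (x - z)) z =
        k n (x - z) * pderiv i χ z - χ z * pderiv i (k n) (x - z) := fun z ↦ by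
      rw [pderiv_mul hχ1 hk1', h2]; ring
    have hkx : MemLp (fun z ↦ k n (x - z)) 2 (volume.restrict (Ω : Set (Euc N))) :=
      memLp_of_continuous hb hk1'.continuous 2
    have hdkx : MemLp (fun z ↦ pderiv i (k n) (x - z)) 2 (volume.restrict (Ω : Set (Euc N))) :=
      memLp_of_continuous hb ((continuous_pderiv hk1 i).comp (by fun_prop)) 2
    have i1 := (hbm (continuous_pderiv hχ1 i) (hdχc i) h.memLp).integrable_mul hkx
    have i2 := hB.integrable_mul hdkx
    have i3 := (hbm hχ.continuous hχc (h.memLp_deriv i)).integrable_mul hkx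
    have e1 : ∫ z in (Ω : Set (Euc N)), P z * pderiv i (fun z ↦ χ z * k n (x - z)) z =
        (∫ z in (Ω : Set (Euc N)), (pderiv i χ z * P z) * k n (x - z)) -
        ∫ z in (Ω : Set (Euc N)), (χ z * P z) * pderiv i (k n) (x - z) := by
      refine Eq.trans ?_ (integral_sub i1 i2)
      congr 1; ext z
      simp only [h3]; ring
    have e2 : ∫ z in (Ω : Set (Euc N)), (pderiv i χ z * P z + χ z * G i z) * k n (x - z) =
        (∫ z in (Ω : Set (Euc N)), (pderiv i χ z * P z) * k n (x - z)) +
        ∫ z in (Ω : Set (Euc N)), (χ z * G i z) * k n (x - z) := by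
      refine Eq.trans ?_ (integral_add i1 i3)
      congr 1; ext z
      ring
    have e3 : ∫ z in (Ω : Set (Euc N)), G i z * (χ z * k n (x - z)) =
        ∫ z in (Ω : Set (Euc N)), (χ z * G i z) * k n (x - z) := by
      congr 1; ext z; ring
    rw [hextint, hextint, e2]
    rw [e1, e3] at h1
    linarith
  have hφsupp : ∀ n, HasCompactSupport (φ n) ∧ tsupport (φ n) ⊆ Ω := by
    intro n
    obtain ⟨K', hK'Ω, hK'c, hK'⟩ := hkK n
    have hs : Function.support (φ n) ⊆ K' := by
      intro x hx
      by_contra hxK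
      refine hx (integral_eq_zero_of_ae (ae_of_all _ fun z ↦ ?_))
      by_cases hz : z ∈ K
      · have : k n (x - z) = 0 := by
          by_contra h0
          exact hxK (hK' z hz x h0)
        simp [this]
      · have : B z = 0 := by
          by_cases hzΩ : z ∈ (Ω : Set (Euc N))
          · have : χ z = 0 := by
              by_contra h0
              exact hz ⟨subset_closure hzΩ, ball_subset_closedBall (hχs (subset_tsupport _ h0))⟩
            simp [hBdef, this]
          · simp [hBdef, hzΩ]
        simp [this]
    exact ⟨HasCompactSupport.of_support_subset_isCompact hK'c hs,
      (closure_minimal hs hK'c.isClosed).trans hK'Ω⟩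
  have hineq : ∀ n, ∑ i, ∫ x, (Ω : Set (Euc N)).indicator (G i) x * ∫ z, H i z * k n (x - z) ≤
      κ * ∫ x, (Ω : Set (Euc N)).indicator P x * ∫ z, B z * k n (x - z) := by
    intro n
    have h1 := hsub ⟨φ n, (pderiv_convolution hBl (hks n) (hkc n)).1, (hφsupp n).1, (hφsupp n).2⟩
      fun x ↦ integral_nonneg fun z ↦ mul_nonneg
        (indicator_nonneg (fun z _ ↦ mul_nonneg (hχ0 z) (hP z)) z) (hk0 n _)
    simp only [TestFunction.coe_mk] at h1
    simp_rw [hextint]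
    calc _ = ∑ i, ∫ x in (Ω : Set (Euc N)), pderiv i (φ n) x * G i x := by
          simp_rw [hφd, mul_comm]
      _ ≤ _ := h1
      _ = _ := congrArg _ (integral_congr_ae (ae_of_all _ fun x ↦ mul_comm _ _))
  have hl1 : Tendsto (fun n ↦ ∑ i, ∫ x, (Ω : Set (Euc N)).indicator (G i) x *
      ∫ z, H i z * k n (x - z)) atTop
      (𝓝 (∑ i, ∫ x, (Ω : Set (Euc N)).indicator (G i) x * H i x)) :=
    tendsto_finsetSum _ fun i _ ↦ tendsto_integral_mul_convolution (hext (h.memLp_deriv i))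
      (hext (hH i)) (fun n ↦ (hks n).continuous) hkc hk0 hk1 hδ hkδ
  have hl2 := (tendsto_integral_mul_convolution (hext h.memLp) (hext hB)
    (fun n ↦ (hks n).continuous) hkc hk0 hk1 hδ hkδ).const_mul κ
  have hfin := le_of_tendsto_of_tendsto' hl1 hl2 hineq
  have hlast : ∀ a b : Euc N → ℝ, ∫ x, (Ω : Set (Euc N)).indicator a x *
      (Ω : Set (Euc N)).indicator b x = ∫ x in (Ω : Set (Euc N)), a x * b x := fun a b ↦ by
    rw [hextint]
    refine setIntegral_congr_fun hΩm fun x hx ↦ ?_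
    simp only [indicator_of_mem hx]
  simpa only [hHdef, hlast] using hfin

/-- A function with zero trace such that `-Δ P ≤ κ P` weakly in `Ω` may be used as its own test
function. -/
lemma sum_integral_sq_le (hN : 1 ≤ N) (hΩ : IsSmoothBoundedDomain Ω)
    (h : H1Approx Ω P G Ψ)
    (htr : Tendsto (fun k ↦ eLpNorm (Ψ k) 2 (surfaceMeasure Ω)) atTop (𝓝 0))
    (hP : ∀ x, 0 ≤ P x) {κ : ℝ}
    (hsub : ∀ φ : 𝓓(Ω, ℝ), (∀ x, 0 ≤ φ x) →
      ∑ i, ∫ x in (Ω : Set (Euc N)), pderiv i φ x * G i x ≤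
        κ * ∫ x in (Ω : Set (Euc N)), φ x * P x) :
    ∑ i, ∫ x in (Ω : Set (Euc N)), G i x ^ 2 ≤ κ * ∫ x in (Ω : Set (Euc N)), P x ^ 2 := by
  have hb := hΩ.2.1
  have hΩm : MeasurableSet (Ω : Set (Euc N)) := Ω.isOpen.measurableSet
  have hKc := hb.isCompact_closure
  have hshift := fun x₀ (hx₀ : x₀ ∈ closure (Ω : Set (Euc N))) ↦ hΩ.2.2.exists_shift hx₀
  choose! ρ ν hρ hshift using hshift
  obtain ⟨s, χ, hχ, hsum⟩ := exists_smooth_partition hKc ρ hρ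
  have hloc := fun j : s ↦ h.sum_integral_mul_localized_le hN hΩ htr hP hsub (hρ j (hχ j).1)
    (hshift j (hχ j).1) (hχ j).2.1 (fun x ↦ ((hχ j).2.2.1 x).1) (hχ j).2.2.2
  have hχ1 : ∀ j : s, ContDiff ℝ 1 (χ j) := fun j ↦ (hχ j).2.1.of_le (by simp)
  have hbm : ∀ {c a : Euc N → ℝ}, Continuous c →
      MemLp a 2 (volume.restrict (Ω : Set (Euc N))) →
      MemLp (fun x ↦ c x * a x) 2 (volume.restrict (Ω : Set (Euc N))) := by
    intro c a hc ha
    obtain ⟨C, hC⟩ := hKc.exists_bound_of_continuousOn hc.continuousOn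
    refine MemLp.of_le_mul (c := C) ha (hc.aestronglyMeasurable.mul ha.1) ?_
    filter_upwards [ae_restrict_mem hΩm] with x hx
    rw [norm_mul]
    gcongr
    exact hC x (subset_closure hx)
  have hdsum : ∀ i, ∀ x ∈ (Ω : Set (Euc N)), ∑ j, pderiv i (χ j) x = 0 := by
    intro i x hx
    have h1 : (fun x ↦ ∑ j, χ j x) =ᶠ[𝓝 x] fun _ ↦ 1 := by
      filter_upwards [Ω.isOpen.mem_nhds hx] with z hz
      exact hsum z (subset_closure hz)
    have h2 := congrArg (fun L : Euc N →L[ℝ] ℝ ↦ L (EuclideanSpace.single i (1 : ℝ))) h1.fderiv_eq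
    rw [fderiv_fun_sum fun j _ ↦ (hχ1 j).differentiable one_ne_zero x] at h2
    simpa [pderiv] using h2
  have hall := Finset.sum_le_sum fun j (_ : j ∈ Finset.univ) ↦ hloc j
  rw [Finset.sum_comm, ← Finset.mul_sum] at hall
  have e1 : ∀ i, ∑ j, ∫ x in (Ω : Set (Euc N)), G i x * (pderiv i (χ j) x * P x + χ j x * G i x) =
      ∫ x in (Ω : Set (Euc N)), G i x ^ 2 := by
    intro i
    rw [← integral_finsetSum]
    · refine setIntegral_congr_fun hΩm fun x hx ↦ ?_
      rw [← Finset.mul_sum, Finset.sum_add_distrib, ← Finset.sum_mul, ← Finset.sum_mul,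
        hdsum i x hx, hsum x (subset_closure hx)]
      ring
    · exact fun j _ ↦ (h.memLp_deriv i).integrable_mul
        ((hbm (continuous_pderiv (hχ1 j) i) h.memLp).add
          (hbm (hχ1 j).continuous (h.memLp_deriv i)))
  have e2 : ∑ j, ∫ x in (Ω : Set (Euc N)), P x * (χ j x * P x) =
      ∫ x in (Ω : Set (Euc N)), P x ^ 2 := by
    rw [← integral_finsetSum]
    · refine setIntegral_congr_fun hΩm fun x hx ↦ ?_
      rw [← Finset.mul_sum, ← Finset.sum_mul, hsum x (subset_closure hx)]
      ring
    · exact fun j _ ↦ h.memLp.integrable_mul (hbm (hχ1 j).continuous h.memLp)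
  simp_rw [e1] at hall
  rwa [e2] at hall

/-- A nonnegative function with zero trace such that `-Δ P ≤ κ P` vanishes if `κ` is small: the
energy inequality contradicts Poincaré's inequality otherwise. -/
lemma ae_eq_zero (hN : 1 ≤ N) (hΩ : IsSmoothBoundedDomain Ω)
    (h : H1Approx Ω P G Ψ)
    (htr : Tendsto (fun k ↦ eLpNorm (Ψ k) 2 (surfaceMeasure Ω)) atTop (𝓝 0))
    (hP : ∀ x, 0 ≤ P x) {κ : ℝ}
    (hsub : ∀ φ : 𝓓(Ω, ℝ), (∀ x, 0 ≤ φ x) →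
      ∑ i, ∫ x in (Ω : Set (Euc N)), pderiv i φ x * G i x ≤
        κ * ∫ x in (Ω : Set (Euc N)), φ x * P x)
    {R : ℝ} (hR : ∀ x ∈ Ω, ‖x‖ ≤ R) (hκ : 4 * R ^ 2 * κ < 1) :
    ∀ᵐ x ∂(volume.restrict (Ω : Set (Euc N))), P x = 0 := by
  have h1 := h.sum_integral_sq_le hN hΩ htr hP hsub
  have h2 := h.integral_sq_le hN hΩ htr hR ⟨0, hN⟩
  have h3 : ∫ x in (Ω : Set (Euc N)), G ⟨0, hN⟩ x ^ 2 ≤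
      ∑ i, ∫ x in (Ω : Set (Euc N)), G i x ^ 2 :=
    Finset.single_le_sum (f := fun i ↦ ∫ x in (Ω : Set (Euc N)), G i x ^ 2)
      (fun i _ ↦ integral_nonneg fun x ↦ sq_nonneg _) (Finset.mem_univ _)
  set I := ∫ x in (Ω : Set (Euc N)), P x ^ 2 with hI
  have hI0 : 0 ≤ I := integral_nonneg fun x ↦ sq_nonneg _
  have h4 : I ≤ 4 * R ^ 2 * (κ * I) :=
    h2.trans (mul_le_mul_of_nonneg_left (h3.trans h1) (by positivity))
  have h5 : I = 0 := by nlinarith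
  have h6 := (integral_eq_zero_iff_of_nonneg (fun x ↦ sq_nonneg (P x)) h.memLp.integrable_sq).mp h5
  filter_upwards [h6] with x hx
  simpa using hx

end H1Approx

/-! ### Regularity of `W^{2,∞}_loc` functions -/

lemma HasWeakPartial.pderiv_convolution {d : ℕ} {i : Fin d} {u w : Euc d → ℝ}
    (h : HasWeakPartial ⊤ i u w) {k : Euc d → ℝ} (hk : ContDiff ℝ (⊤ : ℕ∞) k)
    (hkc : HasCompactSupport k) (x : Euc d) :
    pderiv i (fun x ↦ ∫ z, u z * k (x - z)) x = ∫ z, w z * k (x - z) := by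
  have hu : LocallyIntegrable u volume := by
    have := h.1
    rwa [Opens.coe_top, locallyIntegrableOn_univ] at this
  have hkx : ContDiff ℝ (⊤ : ℕ∞) (fun z ↦ k (x - z)) := hk.comp (contDiff_const.sub contDiff_id)
  have hkxc : HasCompactSupport (fun z ↦ k (x - z)) :=
    hkc.comp_homeomorph (Homeomorph.subLeft x)
  have h1 := h.2.2 ⟨fun z ↦ k (x - z), hkx, hkxc, by simp⟩
  simp only [TestFunction.coe_mk, Opens.coe_top, Measure.restrict_univ, smul_eq_mul] at h1
  have h2 : ∀ z, pderiv i (fun z ↦ k (x - z)) z = -pderiv i k (x - z) := fun z ↦ by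
    have : HasFDerivAt (fun z ↦ k (x - z)) _ z :=
      (hk.differentiable (by simp) (x - z)).hasFDerivAt.comp z ((hasFDerivAt_id z).const_sub x)
    rw [pderiv, this.fderiv]
    simp [pderiv]
  simp_rw [h2, neg_mul] at h1
  rw [integral_neg, neg_inj] at h1
  rw [(SmallParameter.pderiv_convolution hu hk hkc).2 i x]
  simpa only [mul_comm] using h1

/-- Mollifications of an `L^∞_loc` function are bounded on balls, uniformly in the kernel. -/
lemma MemLinftyLoc.exists_convolution_le {d : ℕ} {q : Euc d → ℝ} (hq : MemLinftyLoc q) (M : ℝ) :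
    ∃ C : ℝ, 0 ≤ C ∧ ∀ k : Euc d → ℝ, Continuous k → HasCompactSupport k → (∀ x, 0 ≤ k x) →
      ∫ x, k x = 1 → (∀ x, k x ≠ 0 → ‖x‖ ≤ 1) →
      ∀ x, ‖x‖ ≤ M → ‖∫ z, q z * k (x - z)‖ ≤ C := by
  have h1 := hq (closedBall 0 (M + 1)) (isCompact_closedBall 0 _)
  set C := (eLpNorm q ∞ (volume.restrict (closedBall 0 (M + 1)))).toReal with hC
  refine ⟨C, ENNReal.toReal_nonneg, fun k hk hkc hk0 hk1 hkb x hx ↦ ?_⟩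
  have h2 : ∀ᵐ z ∂(volume.restrict (closedBall (0 : Euc d) (M + 1))), ‖q z‖ ≤ C := by
    have h3 := ae_le_eLpNormEssSup (f := q) (μ := volume.restrict (closedBall (0 : Euc d) (M + 1)))
    filter_upwards [h3] with z hz
    rw [← eLpNorm_exponent_top] at hz
    rw [← toReal_enorm]
    exact ENNReal.toReal_mono h1.eLpNorm_ne_top hz
  rw [ae_restrict_iff' isClosed_closedBall.measurableSet] at h2
  have hkx : Continuous (fun z ↦ k (x - z)) := by fun_prop
  have hkxc : HasCompactSupport (fun z ↦ k (x - z)) :=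
    hkc.comp_homeomorph (Homeomorph.subLeft x)
  refine (norm_integral_le_of_norm_le (g := fun z ↦ C * k (x - z))
    ((hkx.integrable_of_hasCompactSupport hkxc).const_mul C) ?_).trans ?_
  · filter_upwards [h2] with z hz
    rw [norm_mul, Real.norm_of_nonneg (hk0 _)]
    by_cases h0 : k (x - z) = 0
    · simp [h0]
    · refine mul_le_mul_of_nonneg_right (hz ?_) (hk0 _)
      rw [mem_closedBall_zero_iff]
      have := norm_sub_le x (x - z)
      rw [sub_sub_cancel] at this
      linarith [hkb _ h0]
  · rw [integral_const_mul, integral_sub_left_eq_self k volume x, hk1, mul_one]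

lemma norm_clm_le_sum {d : ℕ} (A : Euc d →L[ℝ] ℝ) :
    ‖A‖ ≤ ∑ j, ‖A (EuclideanSpace.single j 1)‖ := by
  refine A.opNorm_le_bound (by positivity) fun v ↦ ?_
  conv_lhs => rw [← (EuclideanSpace.basisFun (Fin d) ℝ).sum_repr v]
  rw [map_sum, Finset.sum_mul]
  refine (norm_sum_le _ _).trans (Finset.sum_le_sum fun j _ ↦ ?_)
  simp only [EuclideanSpace.basisFun_repr, EuclideanSpace.basisFun_apply, map_smul, norm_smul]
  rw [mul_comm]
  gcongr
  exact PiLp.norm_apply_le v j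

lemma hasFDerivAt_of_norm_sub_le_sq {E : Type*} [NormedAddCommGroup E] [NormedSpace ℝ E]
    {f : E → ℝ} {x : E} {a : E →L[ℝ] ℝ} {L : ℝ}
    (h : ∀ᶠ z in 𝓝 x, ‖f z - f x - a (z - x)‖ ≤ L * ‖z - x‖ ^ 2) : HasFDerivAt f a x := by
  have h1 : HasFDerivAt (fun z ↦ f z - f x - a (z - x)) (0 : E →L[ℝ] ℝ) x := by
    refine Asymptotics.IsBigO.hasFDerivAt (n := 2) (Asymptotics.IsBigO.of_bound L ?_) one_lt_two
    simpa using h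
  have h2 := (h1.add_const (f x)).add (a.hasFDerivAt.comp x ((hasFDerivAt_id x).sub_const x))
  exact (h2.congr_fderiv (by ext z; simp)).congr_of_eventuallyEq
    (Eventually.of_forall fun z ↦ by simp; ring)

/-- The gradient of a continuous function in `W^{2,∞}_loc` is Lipschitz on bounded sets. The
gradients of the mollified functions are uniformly bounded and uniformly Lipschitz on a ball, so at
two given points they converge along a common subsequence; Taylor's formula with a uniform quadratic
remainder identifies the limits as the gradients of `f`. -/
theorem MemW2InftyLoc.exists_norm_gradient_sub_le {d : ℕ} {f : Euc d → ℝ} (hf : MemW2InftyLoc f)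
    (hfc : Continuous f) (M : ℝ) :
    ∃ L : ℝ, 0 ≤ L ∧ ∀ x y, ‖x‖ ≤ M → ‖y‖ ≤ M →
      ‖gradient f x - gradient f y‖ ≤ L * ‖x - y‖ := by
  obtain ⟨-, p, q, hp, hq⟩ := hf
  have hCp := fun i ↦ (hp i).1.exists_convolution_le (M + 1)
  have hCq := fun i j ↦ (hq i j).1.exists_convolution_le (M + 1)
  choose Cp hCp0 hCp using hCp
  choose Cq hCq0 hCq using hCq
  set L : ℝ := ∑ i, ∑ j, Cq i j with hL
  have hL0 : 0 ≤ L := Finset.sum_nonneg fun i _ ↦ Finset.sum_nonneg fun j _ ↦ hCq0 i j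
  let β : ℕ → ContDiffBump (0 : Euc d) := fun n ↦
    ⟨1 / ((n : ℝ) + 1) / 2, 1 / ((n : ℝ) + 1), by positivity, half_lt_self (by positivity)⟩
  set k : ℕ → Euc d → ℝ := fun n ↦ (β n).normed volume with hk
  have hks : ∀ n, ContDiff ℝ (⊤ : ℕ∞) (k n) := fun n ↦ (β n).contDiff_normed
  have hkc : ∀ n, HasCompactSupport (k n) := fun n ↦ (β n).hasCompactSupport_normed
  have hk0 : ∀ n x, 0 ≤ k n x := fun n x ↦ (β n).nonneg_normed x
  have hk1 : ∀ n, ∫ x, k n x = 1 := fun n ↦ (β n).integral_normed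
  have hkb : ∀ n x, k n x ≠ 0 → ‖x‖ ≤ 1 := fun n x hx ↦ by
    have h1 : x ∈ Function.support (k n) := hx
    rw [hk, (β n).support_normed_eq, mem_ball_zero_iff] at h1
    refine h1.le.trans ?_
    change 1 / ((n : ℝ) + 1) ≤ 1
    rw [div_le_one (by positivity)]
    linarith [n.cast_nonneg (α := ℝ)]
  set F : ℕ → Euc d → ℝ := fun n x ↦ ∫ z, f z * k n (x - z) with hF
  have hFs : ∀ n, ContDiff ℝ (⊤ : ℕ∞) (F n) := fun n ↦
    (pderiv_convolution hfc.locallyIntegrable (hks n) (hkc n)).1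
  have hFd : ∀ n i, pderiv i (F n) = fun x ↦ ∫ z, p i z * k n (x - z) := fun n i ↦
    funext fun x ↦ (hp i).2.pderiv_convolution (hks n) (hkc n) x
  have hFdd : ∀ n i j x, pderiv j (pderiv i (F n)) x = ∫ z, q i j z * k n (x - z) :=
    fun n i j x ↦ by
      rw [hFd]
      exact (hq i j).2.pderiv_convolution (hks n) (hkc n) x
  have hlim : ∀ x, Tendsto (fun n ↦ F n x) atTop (𝓝 (f x)) := by
    intro x
    have h1 := ContDiffBump.convolution_tendsto_right_of_continuous (μ := volume) (φ := β)
      (l := atTop) tendsto_one_div_add_atTop_nhds_zero_nat hfc x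
    refine h1.congr fun n ↦ ?_
    rw [convolution_def, hF]
    simp only
    rw [← integral_sub_left_eq_self _ _ x]
    congr 1; ext z
    simp [hk, mul_comm]
  -- the gradients of the mollified functions are uniformly bounded and uniformly Lipschitz
  have hbd : ∀ n x, ‖x‖ ≤ M + 1 → ‖fderiv ℝ (F n) x‖ ≤ ∑ i, Cp i := fun n x hx ↦ by
    refine (norm_clm_le_sum _).trans (Finset.sum_le_sum fun i _ ↦ ?_)
    have : fderiv ℝ (F n) x (EuclideanSpace.single i 1) = ∫ z, p i z * k n (x - z) :=
      congrFun (hFd n i) x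
    rw [this]
    exact hCp i (k n) (hks n).continuous (hkc n) (hk0 n) (hk1 n) (hkb n) x hx
  have hlip : ∀ n x y, ‖x‖ ≤ M + 1 → ‖y‖ ≤ M + 1 →
      ‖fderiv ℝ (F n) x - fderiv ℝ (F n) y‖ ≤ L * ‖x - y‖ := fun n x y hx hy ↦ by
    refine (norm_clm_le_sum _).trans ?_
    rw [hL, Finset.sum_mul]
    refine Finset.sum_le_sum fun i _ ↦ ?_
    refine (convex_closedBall (0 : Euc d) (M + 1)).norm_image_sub_le_of_norm_fderiv_le
      (f := pderiv i (F n)) (𝕜 := ℝ)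
      (fun z _ ↦ (contDiff_pderiv (hFs n) i).differentiable (by simp) z) (fun z hz ↦ ?_)
      (by simpa using hy) (by simpa using hx)
    refine (norm_clm_le_sum _).trans (Finset.sum_le_sum fun j _ ↦ ?_)
    have : fderiv ℝ (pderiv i (F n)) z (EuclideanSpace.single j 1) =
      ∫ t, q i j t * k n (z - t) := hFdd n i j z
    rw [this]
    exact hCq i j (k n) (hks n).continuous (hkc n) (hk0 n) (hk1 n) (hkb n) z (by simpa using hz)
  have htaylor : ∀ n x z, ‖x‖ ≤ M + 1 → ‖z‖ ≤ M + 1 →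
      ‖F n z - F n x - fderiv ℝ (F n) x (z - x)‖ ≤ L * ‖z - x‖ ^ 2 := fun n x z hx hz ↦ by
    have h1 := (convex_segment (𝕜 := ℝ) x z).norm_image_sub_le_of_norm_fderiv_le' (f := F n)
      (φ := fderiv ℝ (F n) x) (C := L * ‖z - x‖)
      (fun t _ ↦ (hFs n).differentiable (by simp) t) (fun t ht ↦ ?_)
      (left_mem_segment ℝ x z) (right_mem_segment ℝ x z)
    · rwa [mul_assoc, ← sq] at h1
    · have ht' : ‖t‖ ≤ M + 1 := by
        have := (convex_closedBall (0 : Euc d) (M + 1)).segment_subset (x := x) (y := z)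
          (by simpa using hx) (by simpa using hz) ht
        simpa using this
      refine (hlip n t x ht' hx).trans ?_
      gcongr
      rw [← dist_eq_norm, ← dist_eq_norm, dist_comm, dist_comm z]
      have := dist_add_dist_of_mem_segment ht
      linarith [dist_nonneg (x := t) (y := z)]
  refine ⟨L, hL0, fun x y hx hy ↦ ?_⟩
  -- a common subsequence along which the gradients converge at `x` and at `y`
  obtain ⟨⟨a, b⟩, -, s, hs, hab⟩ := ((isCompact_closedBall (0 : Euc d →L[ℝ] ℝ) (∑ i, Cp i)).prod
    (isCompact_closedBall (0 : Euc d →L[ℝ] ℝ) (∑ i, Cp i))).tendsto_subseq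
    (x := fun n ↦ (fderiv ℝ (F n) x, fderiv ℝ (F n) y))
    (fun n ↦ ⟨by simpa using hbd n x (by linarith), by simpa using hbd n y (by linarith)⟩)
  rw [nhds_prod_eq] at hab
  have ha : Tendsto (fun n ↦ fderiv ℝ (F (s n)) x) atTop (𝓝 a) := tendsto_fst.comp hab
  have hb : Tendsto (fun n ↦ fderiv ℝ (F (s n)) y) atTop (𝓝 b) := tendsto_snd.comp hab
  have hder : ∀ (x : Euc d) (a : Euc d →L[ℝ] ℝ), ‖x‖ ≤ M →
      Tendsto (fun n ↦ fderiv ℝ (F (s n)) x) atTop (𝓝 a) → HasFDerivAt f a x := by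
    intro x a hx ha
    refine hasFDerivAt_of_norm_sub_le_sq (L := L) ?_
    filter_upwards [ball_mem_nhds x one_pos] with z hz
    have hz' : ‖z‖ ≤ M + 1 := by
      have := norm_add_le x (z - x)
      rw [add_sub_cancel] at this
      rw [mem_ball, dist_eq_norm] at hz
      linarith
    have h1 : Tendsto (fun n ↦ F (s n) z - F (s n) x - fderiv ℝ (F (s n)) x (z - x)) atTop
        (𝓝 (f z - f x - a (z - x))) :=
      (((hlim z).comp hs.tendsto_atTop).sub ((hlim x).comp hs.tendsto_atTop)).sub
        (((ContinuousLinearMap.apply ℝ ℝ (z - x)).continuous.tendsto a).comp ha)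
    exact le_of_tendsto h1.norm (Eventually.of_forall fun n ↦ htaylor _ x z (by linarith) hz')
  have hab' : ‖a - b‖ ≤ L * ‖x - y‖ := le_of_tendsto (ha.sub hb).norm
    (Eventually.of_forall fun n ↦ hlip _ x y (by linarith) (by linarith))
  rw [gradient, gradient, (hder x a hx ha).fderiv, (hder y b hy hb).fderiv, ← map_sub,
    LinearIsometryEquiv.norm_map]
  exact hab'

/-! ### Radial convex functions -/

/-- The smooth convex function `√(1 + |y|²)`. -/
noncomputable def bracket {d : ℕ} (y : Euc d) : ℝ := √(1 + ‖y‖ ^ 2)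

section Radial

variable {d : ℕ}

lemma one_le_bracket (y : Euc d) : 1 ≤ bracket y :=
  Real.one_le_sqrt.mpr (by nlinarith [norm_nonneg y])

lemma norm_le_bracket (y : Euc d) : ‖y‖ ≤ bracket y :=
  Real.le_sqrt_of_sq_le (by linarith)

lemma bracket_sq (y : Euc d) : bracket y ^ 2 = 1 + ‖y‖ ^ 2 := Real.sq_sqrt (by positivity)

lemma contDiff_bracket : ContDiff ℝ (⊤ : ℕ∞) (bracket : Euc d → ℝ) :=
  (contDiff_const.add (contDiff_norm_sq ℝ)).sqrt fun y ↦ by positivity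

lemma hasFDerivAt_bracket (y : Euc d) :
    HasFDerivAt bracket ((bracket y)⁻¹ • innerSL ℝ y) y := by
  have h1 : HasFDerivAt (fun y : Euc d ↦ 1 + ‖y‖ ^ 2) (2 • innerSL ℝ y) y :=
    ((hasStrictFDerivAt_norm_sq y).hasFDerivAt).const_add 1
  refine (h1.sqrt (by positivity)).congr_fderiv ?_
  ext v
  simp [bracket]
  ring

variable {s : ℝ → ℝ}

lemma hasFDerivAt_comp_bracket (hs : ContDiff ℝ (⊤ : ℕ∞) s) (y : Euc d) :
    HasFDerivAt (fun y ↦ s (bracket y)) ((deriv s (bracket y) / bracket y) • innerSL ℝ y) y := by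
  have h1 := (hs.differentiable (by simp) (bracket y)).hasDerivAt.comp_hasFDerivAt y
    (hasFDerivAt_bracket y)
  refine h1.congr_fderiv ?_
  rw [smul_smul, div_eq_mul_inv]

lemma norm_fderiv_comp_bracket_le (hs : ContDiff ℝ (⊤ : ℕ∞) s) (h1 : ∀ t, deriv s t ∈ Icc 0 1)
    (y : Euc d) : ‖fderiv ℝ (fun y ↦ s (bracket y)) y‖ ≤ 1 := by
  have hb := one_le_bracket y
  rw [(hasFDerivAt_comp_bracket hs y).fderiv, norm_smul, innerSL_apply_norm,
    Real.norm_of_nonneg (div_nonneg (h1 _).1 (by linarith)), div_mul_eq_mul_div,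
    div_le_one (by linarith)]
  exact (mul_le_of_le_one_left (norm_nonneg _) (h1 _).2).trans (norm_le_bracket y)

lemma fderiv_fderiv_comp_bracket (hs : ContDiff ℝ (⊤ : ℕ∞) s) (y v v' : Euc d) :
    fderiv ℝ (fderiv ℝ (fun y ↦ s (bracket y))) y v v' =
      deriv s (bracket y) / bracket y * ⟪v, v'⟫ +
      (deriv (deriv s) (bracket y) / bracket y ^ 2 - deriv s (bracket y) / bracket y ^ 3) *
        (⟪y, v⟫ * ⟪y, v'⟫) := by
  have hb : bracket y ≠ 0 := (zero_lt_one.trans_le (one_le_bracket y)).ne'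
  have hs' : ContDiff ℝ (⊤ : ℕ∞) (deriv s) := (contDiff_infty_iff_deriv.mp hs).2
  have h0 : fderiv ℝ (fun y : Euc d ↦ s (bracket y)) =
      fun y ↦ (deriv s (bracket y) / bracket y) • innerSL ℝ y :=
    funext fun y ↦ (hasFDerivAt_comp_bracket hs y).fderiv
  have h1 : HasDerivAt (fun t ↦ deriv s t / t) _ (bracket y) :=
    (hs'.differentiable (by simp) (bracket y)).hasDerivAt.div (hasDerivAt_id (bracket y)) hb
  have h2 : HasFDerivAt (fun y : Euc d ↦ deriv s (bracket y) / bracket y) _ y :=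
    h1.comp_hasFDerivAt y (hasFDerivAt_bracket y)
  have h3 : HasFDerivAt (fun y : Euc d ↦ (deriv s (bracket y) / bracket y) • innerSL ℝ y) _ y :=
    h2.smul (innerSL ℝ (E := Euc d)).hasFDerivAt
  rw [h0, h3.fderiv]
  simp
  field_simp
  rw [innerSL_apply_apply]

lemma fderiv_fderiv_comp_bracket_nonneg (hs : ContDiff ℝ (⊤ : ℕ∞) s)
    (h1 : ∀ t, deriv s t ∈ Icc 0 1) (h2 : ∀ t, 0 ≤ deriv (deriv s) t) (y v : Euc d) :
    0 ≤ fderiv ℝ (fderiv ℝ (fun y ↦ s (bracket y))) y v v := by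
  rw [fderiv_fderiv_comp_bracket hs]
  have hb := zero_lt_one.trans_le (one_le_bracket y)
  have h3 : ⟪y, v⟫ * ⟪y, v⟫ ≤ bracket y ^ 2 * ‖v‖ ^ 2 := by
    have h4 := real_inner_mul_inner_self_le y v
    rw [real_inner_self_eq_norm_sq, real_inner_self_eq_norm_sq] at h4
    rw [bracket_sq]
    nlinarith [sq_nonneg ‖v‖]
  have h5 : deriv s (bracket y) / bracket y ^ 3 * (⟪y, v⟫ * ⟪y, v⟫) ≤
      deriv s (bracket y) / bracket y ^ 3 * (bracket y ^ 2 * ‖v‖ ^ 2) :=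
    mul_le_mul_of_nonneg_left h3 (div_nonneg (h1 _).1 (by positivity))
  have h6 : deriv s (bracket y) / bracket y ^ 3 * (bracket y ^ 2 * ‖v‖ ^ 2) =
      deriv s (bracket y) / bracket y * ‖v‖ ^ 2 := by field_simp
  have h7 : 0 ≤ deriv (deriv s) (bracket y) / bracket y ^ 2 * (⟪y, v⟫ * ⟪y, v⟫) :=
    mul_nonneg (div_nonneg (h2 _) (by positivity)) (mul_self_nonneg _)
  rw [real_inner_self_eq_norm_sq, sub_mul]
  linarith

lemma norm_fderiv_fderiv_comp_bracket_le (hs : ContDiff ℝ (⊤ : ℕ∞) s)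
    (h1 : ∀ t, deriv s t ∈ Icc 0 1) {C : ℝ} (h2 : ∀ t, deriv (deriv s) t ∈ Icc 0 C) (y : Euc d) :
    ‖fderiv ℝ (fderiv ℝ (fun y ↦ s (bracket y))) y‖ ≤ C + 2 := by
  have hC : 0 ≤ C := (h2 0).1.trans (h2 0).2
  have hb1 := one_le_bracket y
  have hb := zero_lt_one.trans_le hb1
  refine ContinuousLinearMap.opNorm_le_bound₂ _ (by positivity) fun v v' ↦ ?_
  rw [fderiv_fderiv_comp_bracket hs]
  have e1 : ‖deriv s (bracket y) / bracket y‖ ≤ 1 := by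
    rw [Real.norm_of_nonneg (div_nonneg (h1 _).1 hb.le), div_le_one hb]
    exact (h1 _).2.trans hb1
  have e2 : ‖deriv (deriv s) (bracket y) / bracket y ^ 2 - deriv s (bracket y) / bracket y ^ 3‖ ≤
      (C + 1) / bracket y ^ 2 := by
    refine (norm_sub_le _ _).trans ?_
    rw [Real.norm_of_nonneg (div_nonneg (h2 _).1 (by positivity)),
      Real.norm_of_nonneg (div_nonneg (h1 _).1 (by positivity)), add_div]
    gcongr
    · exact (h2 _).2
    · exact (h1 _).2
    · norm_num
  have e3 : ‖⟪y, v⟫ * ⟪y, v'⟫‖ ≤ bracket y ^ 2 * (‖v‖ * ‖v'‖) := by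
    rw [norm_mul]
    have a1 := (norm_inner_le_norm (𝕜 := ℝ) y v).trans
      (mul_le_mul_of_nonneg_right (norm_le_bracket y) (norm_nonneg v))
    have a2 := (norm_inner_le_norm (𝕜 := ℝ) y v').trans
      (mul_le_mul_of_nonneg_right (norm_le_bracket y) (norm_nonneg v'))
    refine (mul_le_mul a1 a2 (norm_nonneg _) (by positivity)).trans (le_of_eq ?_)
    ring
  refine (norm_add_le _ _).trans ?_
  rw [norm_mul, norm_mul]
  have a3 := mul_le_mul e1 (norm_inner_le_norm (𝕜 := ℝ) v v') (norm_nonneg _) zero_le_one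
  have a4 := mul_le_mul e2 e3 (norm_nonneg _) (by positivity)
  have a5 : (C + 1) / bracket y ^ 2 * (bracket y ^ 2 * (‖v‖ * ‖v'‖)) =
    (C + 1) * (‖v‖ * ‖v'‖) := by field_simp
  rw [a5] at a4
  refine (add_le_add a3 a4).trans (le_of_eq ?_)
  ring

/-- A smooth, convex, nondecreasing function that vanishes exactly on `(-∞, a]`. -/
lemma exists_convex_cutoff (a : ℝ) : ∃ (s : ℝ → ℝ) (C : ℝ), ContDiff ℝ (⊤ : ℕ∞) s ∧
    (∀ t, deriv s t ∈ Icc 0 1) ∧ (∀ t, deriv (deriv s) t ∈ Icc 0 C) ∧ (∀ t, 0 ≤ s t) ∧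
    (∀ t, s t = 0 ↔ t ≤ a) ∧ ∀ t ≤ a, deriv s t = 0 := by
  set m : ℝ → ℝ := fun t ↦ Real.smoothTransition (t - a) with hm
  have hmc : ContDiff ℝ (⊤ : ℕ∞) m := Real.smoothTransition.contDiff.comp (contDiff_id.sub contDiff_const)
  have hmm : Monotone m := fun x y hxy ↦ Real.smoothTransition.monotone (by linarith)
  have hint : ∀ b c, IntervalIntegrable m volume b c := fun b c ↦ hmc.continuous.intervalIntegrable b c
  have hd : ∀ t, HasDerivAt (fun t ↦ ∫ x in a..t, m x) (m t) t := fun t ↦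
    intervalIntegral.integral_hasDerivAt_right (hint _ _)
      hmc.continuous.aestronglyMeasurable.stronglyMeasurableAtFilter hmc.continuous.continuousAt
  have hds : deriv (fun t ↦ ∫ x in a..t, m x) = m := funext fun t ↦ (hd t).deriv
  have hm0 : ∀ t ≤ a, m t = 0 := fun t ht ↦ Real.smoothTransition.zero_of_nonpos (by linarith)
  have hz : ∀ t ≤ a, ∫ x in a..t, m x = 0 := fun t ht ↦ by
    rw [intervalIntegral.integral_symm, neg_eq_zero]
    rw [intervalIntegral.integral_congr (g := fun _ ↦ (0 : ℝ)) fun x hx ↦ ?_]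
    · simp
    · rw [uIcc_of_le ht] at hx
      exact hm0 x hx.2
  have hpos : ∀ t, a < t → 0 < ∫ x in a..t, m x := fun t ht ↦
    intervalIntegral.intervalIntegral_pos_of_pos_on (hint _ _)
      (fun x hx ↦ Real.smoothTransition.pos_of_pos (by linarith [hx.1])) ht
  have hcs : HasCompactSupport (deriv m) := by
    refine HasCompactSupport.of_support_subset_isCompact (isCompact_Icc (a := a) (b := a + 1))
      fun t ht ↦ ?_
    by_contra h
    rw [mem_Icc, not_and_or, not_le, not_le] at h
    refine ht ?_
    rcases h with h | h
    · have : m =ᶠ[𝓝 t] fun _ ↦ 0 := by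
        filter_upwards [gt_mem_nhds h] with z hz using hm0 z hz.le
      rw [this.deriv_eq, deriv_const]
    · have : m =ᶠ[𝓝 t] fun _ ↦ 1 := by
        filter_upwards [lt_mem_nhds h] with z hz
        exact Real.smoothTransition.one_of_one_le (by linarith)
      rw [this.deriv_eq, deriv_const]
  obtain ⟨C, hC⟩ := hcs.exists_bound_of_continuous (hmc.continuous_deriv (by simp))
  refine ⟨fun t ↦ ∫ x in a..t, m x, C, ?_, fun t ↦ ?_, fun t ↦ ?_, fun t ↦ ?_, fun t ↦ ?_,
    fun t ht ↦ ?_⟩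
  · rw [contDiff_infty_iff_deriv, hds]
    exact ⟨fun t ↦ (hd t).differentiableAt, hmc⟩
  · rw [hds]
    exact ⟨Real.smoothTransition.nonneg _, Real.smoothTransition.le_one _⟩
  · rw [hds]
    exact ⟨hmm.deriv_nonneg, (le_abs_self _).trans (hC t)⟩
  · rcases le_or_gt t a with h | h
    · exact (hz t h).ge
    · exact (hpos t h).le
  · refine ⟨fun h ↦ ?_, hz t⟩
    by_contra hlt
    exact (hpos t (not_le.mp hlt)).ne' h
  · rw [hds, hm0 t ht]

end Radial

/-! ### Comparison -/

section Comparison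

variable {N d : ℕ} {Ω : Opens (Euc N)} {u h : Euc N → Euc d} {w : Fin N → Euc N → Euc d}
  {ψ : ℕ → Euc N → Euc d}

/-- Comparison principle: if `Δu = h`, the convex function `p` vanishes on the trace of `u`, and
`p'(u) h ≥ -κ p(u)` with `κ` small, then `p(u) = 0`. -/
theorem H1Approx.ae_comp_eq_zero (hN : 1 ≤ N) (hΩ : IsSmoothBoundedDomain Ω)
    (ha : H1Approx Ω u w ψ) (hw : ∀ i, HasWeakPartial Ω i u (w i))
    (hh : LocallyIntegrableOn h (Ω : Set (Euc N)))
    (hΔ : ∀ φ : 𝓓(Ω, ℝ), ∫ x in (Ω : Set (Euc N)), (Laplacian.laplacian (φ : Euc N → ℝ) x) • u x =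
      ∫ x in (Ω : Set (Euc N)), φ x • h x)
    {p : Euc d → ℝ} (hp : ContDiff ℝ (⊤ : ℕ∞) p) (hp0 : ∀ y, 0 ≤ p y) {L₁ L₂ : ℝ}
    (hL₁ : ∀ y, ‖fderiv ℝ p y‖ ≤ L₁) (hL₂ : ∀ y, ‖fderiv ℝ (fderiv ℝ p) y‖ ≤ L₂)
    (hconv : ∀ y v, 0 ≤ fderiv ℝ (fderiv ℝ p) y v v)
    (htr : Tendsto (fun k ↦ eLpNorm (p ∘ ψ k) 2 (surfaceMeasure Ω)) atTop (𝓝 0))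
    {κ : ℝ} (hκ : ∀ᵐ x ∂(volume.restrict (Ω : Set (Euc N))),
      -(κ * p (u x)) ≤ fderiv ℝ p (u x) (h x))
    {R : ℝ} (hR : ∀ x ∈ Ω, ‖x‖ ≤ R) (hκR : 4 * R ^ 2 * κ < 1) :
    ∀ᵐ x ∂(volume.restrict (Ω : Set (Euc N))), p (u x) = 0 := by
  have hb := hΩ.2.1
  obtain ⟨s, hs, hae⟩ := ha.exists_subseq_tendsto_ae
  have hc := (ha.subseq hs).comp hb hae hp hL₁
  refine hc.ae_eq_zero hN hΩ (htr.comp hs.tendsto_atTop) (fun x ↦ hp0 _) (κ := κ)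
    (fun φ hφ ↦ ?_) hR hκR
  refine (sum_integral_pderiv_mul_le hb (ha.subseq hs) hae hw hh hΔ hp hL₁ hL₂ hconv φ hφ).trans ?_
  obtain ⟨C, hC⟩ := φ.hasCompactSupport.exists_bound_of_continuous φ.continuous
  have hφ2 := memLp_of_continuous (Ω := Ω) hb φ.continuous 2
  rw [← integral_neg, ← integral_const_mul]
  refine integral_mono_ae ?_ ((hφ2.integrable_mul hc.memLp).const_mul κ) ?_
  · refine Integrable.neg ((integrableOn_test_smul φ hh).norm.const_mul L₁ |>.mono' ?_
      (ae_of_all _ fun x ↦ ?_))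
    · exact φ.continuous.aestronglyMeasurable.mul (aestronglyMeasurable_clm_apply
        ((hp.continuous_fderiv (by simp)).comp_aestronglyMeasurable ha.memLp.1)
        hh.aestronglyMeasurable)
    · rw [norm_mul, norm_smul, mul_left_comm]
      gcongr
      exact ((fderiv ℝ p (u x)).le_opNorm _).trans (by gcongr; exact hL₁ _)
  · filter_upwards [hκ] with x hx
    have := mul_le_mul_of_nonneg_left hx (hφ x)
    change -(φ x * fderiv ℝ p (u x) (h x)) ≤ κ * (φ x * p (u x))
    linarith

lemma HasTrace.exists_h1Approx {g : Euc N → Euc d} (hΩ : Bornology.IsBounded (Ω : Set (Euc N)))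
    (h : HasTrace Ω u g) (hu : MemLp u 2 (volume.restrict Ω)) :
    ∃ (w : Fin N → Euc N → Euc d) (ψ : ℕ → Euc N → Euc d), H1Approx Ω u w ψ ∧
      (∀ i, HasWeakPartial Ω i u (w i)) ∧
      Tendsto (fun k ↦ eLpNorm (g - ψ k) 2 (surfaceMeasure Ω)) atTop (𝓝 0) := by
  obtain ⟨ψ, hψ, hψu, hw, hψg⟩ := h
  choose w hw hψw using hw
  refine ⟨w, ψ, ⟨hψ, hu, fun i ↦ ?_, ?_, fun i ↦ ?_⟩, hw, hψg⟩
  · obtain ⟨k, hk⟩ := ((hψw i).eventually (gt_mem_nhds zero_lt_one)).exists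
    have hd : MemLp (pderiv i (ψ k)) 2 (volume.restrict (Ω : Set (Euc N))) :=
      memLp_of_continuous hΩ (continuous_pderiv ((hψ k).of_le (by simp)) i) 2
    have hm : AEStronglyMeasurable (w i) (volume.restrict (Ω : Set (Euc N))) :=
      (hw i).2.1.aestronglyMeasurable
    have h2 : MemLp (w i - pderiv i (ψ k)) 2 (volume.restrict (Ω : Set (Euc N))) :=
      ⟨hm.sub hd.1, hk.trans ENNReal.one_lt_top⟩
    simpa using h2.add hd
  · simpa only [eLpNorm_sub_comm] using hψu
  · simpa only [eLpNorm_sub_comm] using hψw i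

lemma integrableOn_laplacian_smul (φ : 𝓓(Ω, ℝ)) (hu : LocallyIntegrableOn u (Ω : Set (Euc N))) :
    IntegrableOn (fun x ↦ Laplacian.laplacian (φ : Euc N → ℝ) x • u x) (Ω : Set (Euc N)) := by
  simp_rw [laplacian_eq_sum_pderiv φ.contDiff, Finset.sum_smul]
  exact integrable_finsetSum _ fun i _ ↦ integrableOn_test_smul (pderivTest i (pderivTest i φ)) hu

lemma HasWeakPartial.sub {F : Type*} [NormedAddCommGroup F] [NormedSpace ℝ F] {i : Fin N}
    {u u' w w' : Euc N → F}
    (h : HasWeakPartial Ω i u w) (h' : HasWeakPartial Ω i u' w') :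
    HasWeakPartial Ω i (u - u') (w - w') := by
  refine ⟨h.1.sub h'.1, h.2.1.sub h'.2.1, fun φ ↦ ?_⟩
  simp only [Pi.sub_apply, smul_sub]
  have e1 := integral_sub (integrableOn_test_smul (pderivTest i φ) h.1)
    (integrableOn_test_smul (pderivTest i φ) h'.1)
  have e2 := integral_sub (integrableOn_test_smul φ h.2.1) (integrableOn_test_smul φ h'.2.1)
  rw [e2]
  refine e1.trans ?_
  rw [neg_sub', ← h.2.2 φ, ← h'.2.2 φ]
  rfl

end Comparison

/-! ### Critical points -/

section Main

variable {N d : ℕ} {Ω : Opens (Euc N)} {f : Euc d → ℝ} {lam : ℝ} {u v g : Euc N → Euc d}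

lemma IsCriticalPoint.integral_laplacian_smul (h : IsCriticalPoint Ω f lam u) (φ : 𝓓(Ω, ℝ)) :
    ∫ x in (Ω : Set (Euc N)), (Laplacian.laplacian (φ : Euc N → ℝ) x) • u x =
      ∫ x in (Ω : Set (Euc N)), φ x • lam ^ 2 • gradient f (u x) := by
  rw [h.2.2 φ, ← integral_smul]
  congr 1; ext1 x
  rw [smul_comm]

/-- Maximum principle: a critical point takes values in a ball which contains its boundary values
and outside which `∇f(x) · x ≥ 0`. This is the comparison principle for a convex radial function
that vanishes exactly on the ball, with `κ = 0`. -/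
theorem IsCriticalPoint.ae_norm_le (hN : 1 ≤ N) (hΩ : IsSmoothBoundedDomain Ω) {M : ℝ} (hM : 0 ≤ M)
    (hf : ∀ x, M ≤ ‖x‖ → 0 ≤ ⟪gradient f x, x⟫)
    (hg : ∀ᵐ x ∂(surfaceMeasure Ω), ‖g x‖ ≤ M)
    (hu : IsCriticalPoint Ω f lam u) (hug : HasTrace Ω u g) :
    ∀ᵐ x ∂(volume.restrict (Ω : Set (Euc N))), ‖u x‖ ≤ M := by
  obtain ⟨R, hR⟩ := hΩ.2.1.exists_norm_le
  obtain ⟨w, ψ, ha, hw, hψg⟩ := hug.exists_h1Approx hΩ.2.1 hu.1.1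
  obtain ⟨s, C, hs, hs1, hs2, hs0, hsz, hsd⟩ := exists_convex_cutoff √(1 + M ^ 2)
  have hle : ∀ y : Euc d, bracket y ≤ √(1 + M ^ 2) ↔ ‖y‖ ≤ M := fun y ↦ by
    rw [bracket, Real.sqrt_le_sqrt_iff (by positivity), add_le_add_iff_left,
      sq_le_sq₀ (norm_nonneg _) hM]
  have hp : ContDiff ℝ (⊤ : ℕ∞) fun y : Euc d ↦ s (bracket y) := hs.comp contDiff_bracket
  have hL := norm_fderiv_comp_bracket_le (d := d) hs hs1
  have hlip : ∀ y z : Euc d, ‖s (bracket y) - s (bracket z)‖ ≤ 1 * ‖y - z‖ := fun y z ↦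
    convex_univ.norm_image_sub_le_of_norm_fderiv_le
      (fun y _ ↦ hp.differentiable (by simp) y) (fun y _ ↦ hL y) (mem_univ z) (mem_univ y)
  have hmain := ha.ae_comp_eq_zero (h := fun x ↦ lam ^ 2 • gradient f (u x)) hN hΩ hw
    (hu.2.1.smul (lam ^ 2)) hu.integral_laplacian_smul (p := fun y ↦ s (bracket y)) hp (fun y ↦ hs0 _)
    hL (norm_fderiv_fderiv_comp_bracket_le hs hs1 hs2)
    (fderiv_fderiv_comp_bracket_nonneg hs hs1 fun t ↦ (hs2 t).1) ?_ (κ := 0) ?_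
    (fun x hx ↦ hR x hx) (by simp)
  · filter_upwards [hmain] with x hx
    exact (hle _).mp ((hsz _).mp hx)
  · refine tendsto_eLpNorm_of_le 1 (fun k ↦ ?_) hψg
    filter_upwards [hg] with x hx
    have h1 : s (bracket (g x)) = 0 := (hsz _).mpr ((hle _).mpr hx)
    have h2 := hlip (ψ k x) (g x)
    rw [h1, sub_zero, norm_sub_rev] at h2
    exact h2
  · refine ae_of_all _ fun x ↦ ?_
    rw [(hasFDerivAt_comp_bracket hs (u x)).fderiv]
    simp only [zero_mul, neg_zero, _root_.smul_apply, innerSL_apply_apply, smul_eq_mul]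
    rw [inner_smul_right, real_inner_comm]
    rcases le_total ‖u x‖ M with h1 | h1
    · rw [hsd _ ((hle _).mpr h1)]; simp
    · have h3 := zero_lt_one.trans_le (one_le_bracket (u x))
      exact mul_nonneg (div_nonneg (hs1 _).1 h3.le) (mul_nonneg (sq_nonneg _) (hf _ h1))

/-- Two critical points with the same trace and values in a ball where `∇f` is `L`-Lipschitz
coincide if `lam` is small. This is the comparison principle for `√(1 + |u - v|²) - 1`, with
`κ = 2 lam² L`. -/
theorem IsCriticalPoint.ae_eq (hN : 1 ≤ N) (hΩ : IsSmoothBoundedDomain Ω) {M L R : ℝ}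
    (hL0 : 0 ≤ L) (hL : ∀ x y, ‖x‖ ≤ M → ‖y‖ ≤ M → ‖gradient f x - gradient f y‖ ≤ L * ‖x - y‖)
    (hu : IsCriticalPoint Ω f lam u) (hug : HasTrace Ω u g)
    (hv : IsCriticalPoint Ω f lam v) (hvg : HasTrace Ω v g)
    (hg : AEStronglyMeasurable g (surfaceMeasure Ω))
    (huM : ∀ᵐ x ∂(volume.restrict (Ω : Set (Euc N))), ‖u x‖ ≤ M)
    (hvM : ∀ᵐ x ∂(volume.restrict (Ω : Set (Euc N))), ‖v x‖ ≤ M)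
    (hR : ∀ x ∈ Ω, ‖x‖ ≤ R) (hlam : 4 * R ^ 2 * (2 * lam ^ 2 * L) < 1) :
    u =ᵐ[volume.restrict Ω] v := by
  obtain ⟨w, ψ, ha, hw, hψg⟩ := hug.exists_h1Approx hΩ.2.1 hu.1.1
  obtain ⟨w', ψ', ha', hw', hψg'⟩ := hvg.exists_h1Approx hΩ.2.1 hv.1.1
  have hs : ContDiff ℝ (⊤ : ℕ∞) fun t : ℝ ↦ t - 1 := by fun_prop
  have hs1 : deriv (fun t : ℝ ↦ t - 1) = fun _ ↦ 1 := by ext t; simp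
  have hs1' : ∀ t : ℝ, deriv (fun t : ℝ ↦ t - 1) t ∈ Icc 0 1 := fun t ↦ by simp
  have hs2 : ∀ t : ℝ, deriv (deriv (fun t : ℝ ↦ t - 1)) t ∈ Icc 0 0 := fun t ↦ by simp [hs1]
  have hp : ContDiff ℝ (⊤ : ℕ∞) fun y : Euc d ↦ bracket y - 1 := hs.comp contDiff_bracket
  have hp0 : ∀ y : Euc d, bracket y - 1 ≤ ‖y‖ := fun y ↦ by
    have := bracket_sq y
    nlinarith [norm_nonneg y, one_le_bracket y]
  have hloc : LocallyIntegrableOn (fun x ↦ lam ^ 2 • (gradient f (u x) - gradient f (v x)))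
      (Ω : Set (Euc N)) := (hu.2.1.sub hv.2.1).smul (lam ^ 2)
  have hul : LocallyIntegrableOn u (Ω : Set (Euc N)) := (hw ⟨0, hN⟩).1
  have hvl : LocallyIntegrableOn v (Ω : Set (Euc N)) := (hw' ⟨0, hN⟩).1
  have hmain := (ha.sub ha').ae_comp_eq_zero
    (h := fun x ↦ lam ^ 2 • (gradient f (u x) - gradient f (v x))) hN hΩ
    (fun i ↦ (hw i).sub (hw' i)) hloc (fun φ ↦ ?_) (p := fun y ↦ bracket y - 1) hp
    (fun y ↦ by linarith [one_le_bracket y]) (norm_fderiv_comp_bracket_le hs hs1')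
    (norm_fderiv_fderiv_comp_bracket_le hs hs1' hs2)
    (fderiv_fderiv_comp_bracket_nonneg hs hs1' fun t ↦ (hs2 t).1) ?_ (κ := 2 * lam ^ 2 * L) ?_
    hR hlam
  · filter_upwards [hmain] with x hx
    have h1 := bracket_sq ((u - v) x)
    have h2 : bracket ((u - v) x) = 1 := by linarith
    rw [h2] at h1
    have h3 : ‖(u - v) x‖ = 0 := by nlinarith [norm_nonneg ((u - v) x)]
    simpa [sub_eq_zero] using h3
  · simp only [Pi.sub_apply, smul_sub]
    rw [integral_sub (integrableOn_laplacian_smul φ hul) (integrableOn_laplacian_smul φ hvl),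
      hu.integral_laplacian_smul, hv.integral_laplacian_smul]
    exact (integral_sub (integrableOn_test_smul φ (hu.2.1.smul (lam ^ 2)))
        (integrableOn_test_smul φ (hv.2.1.smul (lam ^ 2)))).symm
  · have h0 := hψg.add hψg'
    rw [add_zero] at h0
    refine tendsto_of_tendsto_of_tendsto_of_le_of_le tendsto_const_nhds h0 (fun _ ↦ zero_le)
      fun k ↦ ?_
    have h1 : eLpNorm ((fun y : Euc d ↦ bracket y - 1) ∘ (ψ - ψ') k) 2 (surfaceMeasure Ω) ≤
        eLpNorm ((g - ψ' k) - (g - ψ k)) 2 (surfaceMeasure Ω) := by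
      refine eLpNorm_mono fun x ↦ ?_
      have h2 : ((g - ψ' k) - (g - ψ k)) x = (ψ - ψ') k x := by simp
      rw [h2, Function.comp_apply, Real.norm_of_nonneg (by linarith [one_le_bracket ((ψ - ψ') k x)])]
      exact hp0 _
    refine h1.trans ((eLpNorm_sub_le (hg.sub (ha'.contDiff k).continuous.aestronglyMeasurable)
      (hg.sub (ha.contDiff k).continuous.aestronglyMeasurable) (by norm_num)).trans ?_)
    rw [add_comm]
  · filter_upwards [huM, hvM] with x hux hvx
    have hd := (hasFDerivAt_comp_bracket hs ((u - v) x)).fderiv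
    simp only [hs1] at hd
    rw [hd]
    simp only [_root_.smul_apply, innerSL_apply_apply, smul_eq_mul, Pi.sub_apply]
    set z := u x - v x with hz
    set q := bracket z with hq
    have hq1 : 1 ≤ q := one_le_bracket z
    have hq2 : q ^ 2 = 1 + ‖z‖ ^ 2 := bracket_sq z
    rw [inner_smul_right]
    have h1 : -(L * ‖z‖ ^ 2) ≤ ⟪z, gradient f (u x) - gradient f (v x)⟫ := by
      have h2 := (abs_real_inner_le_norm z (gradient f (u x) - gradient f (v x))).trans
        (mul_le_mul_of_nonneg_left (hL _ _ hux hvx) (norm_nonneg z))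
      have h3 := neg_abs_le ⟪z, gradient f (u x) - gradient f (v x)⟫
      rw [← hz] at h2
      nlinarith
    have h4 : ‖z‖ ^ 2 = (q - 1) * (q + 1) := by linarith
    have h5 : -(lam ^ 2 * (L * ‖z‖ ^ 2)) ≤
        lam ^ 2 * ⟪z, gradient f (u x) - gradient f (v x)⟫ := by
      have := mul_le_mul_of_nonneg_left h1 (sq_nonneg lam)
      linarith
    rw [one_div, inv_mul_eq_div, le_div_iff₀ (by linarith)]
    refine le_trans ?_ h5
    rw [h4]
    have h6 : 0 ≤ lam ^ 2 * L * (q - 1) * (q - 1) := by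
      have : 0 ≤ q - 1 := by linarith
      positivity
    nlinarith

end Main

end SmallParameter

theorem mainTheorem6 {N d : ℕ} (hN : 1 ≤ N)
    (Ω : TopologicalSpace.Opens (SmallParameter.Euc N))
    (hΩ : SmallParameter.IsSmoothBoundedDomain Ω)
    (f : SmallParameter.Euc d → ℝ) (hf : SmallParameter.MemW2InftyLoc f) (hfc : Continuous f)
    (hcoer : ∃ C : ℝ, 0 < C ∧ ∀ x, C ≤ ‖x‖ → 0 ≤ inner ℝ (gradient f x) x)
    (g : SmallParameter.Euc N → SmallParameter.Euc d)
    (hg_bdd : MemLp g ∞ (SmallParameter.surfaceMeasure Ω))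
    (hg_half : SmallParameter.MemHHalf Ω g) :
    ∃ lam₀ : ℝ, 0 < lam₀ ∧ ∀ lam : ℝ, 0 < lam → lam < lam₀ →
      ∀ u v : SmallParameter.Euc N → SmallParameter.Euc d,
        SmallParameter.IsCriticalPoint Ω f lam u → SmallParameter.HasTrace Ω u g →
        SmallParameter.IsCriticalPoint Ω f lam v → SmallParameter.HasTrace Ω v g →
          u =ᵐ[volume.restrict Ω] v := by
  obtain ⟨C, hC, hcoer⟩ := hcoer
  obtain ⟨R, hR0, hR⟩ := hΩ.2.1.exists_pos_norm_le
  set M : ℝ := max C (eLpNorm g ∞ (SmallParameter.surfaceMeasure Ω)).toReal with hM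
  have hM0 : 0 ≤ M := hC.le.trans (le_max_left _ _)
  have hgM : ∀ᵐ x ∂(SmallParameter.surfaceMeasure Ω), ‖g x‖ ≤ M := by
    filter_upwards [ae_le_eLpNormEssSup (f := g)
      (μ := SmallParameter.surfaceMeasure Ω)] with x hx
    rw [← eLpNorm_exponent_top] at hx
    refine le_trans ?_ (le_max_right _ _)
    rw [← toReal_enorm]
    exact ENNReal.toReal_mono hg_bdd.eLpNorm_ne_top hx
  obtain ⟨L, hL0, hL⟩ := hf.exists_norm_gradient_sub_le hfc M
  refine ⟨1 / (4 * R * (L + 1)), by positivity, fun lam hlam hlt u v hu hug hv hvg ↦ ?_⟩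
  have hcoer' : ∀ x, M ≤ ‖x‖ → 0 ≤ inner ℝ (gradient f x) x := fun x hx ↦
    hcoer x ((le_max_left _ _).trans hx)
  refine hu.ae_eq hN hΩ hL0 hL hug hv hvg hg_bdd.1
    (hu.ae_norm_le hN hΩ hM0 hcoer' hgM hug) (hv.ae_norm_le hN hΩ hM0 hcoer' hgM hvg)
    (fun x hx ↦ hR x hx) ?_
  rw [lt_div_iff₀ (by positivity)] at hlt
  have h1 : (lam * (4 * R * (L + 1))) ^ 2 < 1 := by
    rw [sq_lt_one_iff₀ (by positivity)]
    exact hlt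
  have h2 : L ≤ (L + 1) ^ 2 := by nlinarith
  have h3 : 0 ≤ lam ^ 2 * R ^ 2 := by positivity
  nlinarith [mul_le_mul_of_nonneg_left h2 h3]
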